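/- Let $X$ and $P$ be finite disjoint sets and let $bl\colon P\to (X\cup X^{-1})^*$ be a map (so $bl(\rho)$ is the label of the boundary walk of the $2$-cell $\rho$ in the $2$-complex $B_{X,P}$ that has one $0$-cell, whose $1$-cells are labeled by $X$ and whose $2$-cells are labeled by $P$). Let $$M_{X,P}=\mathrm{Inv}\langle X\cup P \mid \rho^2=\rho,\ \rho=\rho\, bl(\rho)\ (\rho\in P)\rangle ,$$ an inverse monoid with natural partial order $a\le b \iff a=eb$ for some idempotent $e$. A word is a word over $X\cup P$ and formal inverses. For $m\in M_{X,P}$ the Schützenberger graph of $m$ has as vertices the elements $u\in M_{X,P}$ with $uu^{-1}=mm^{-1}$ and an edge labeled $x$ from $u$ to $v$ whenever $x$ is a generator or the inverse of one and $ux=v$; the Schützenberger automaton of $m$ is this graph with initial vertex $mm^{-1}$ and terminal vertex $m$. A closed inverse submonoid is an inverse submonoid that is upwards closed in the natural partial order; for a set $Y$ of words, $\langle Y\rangle^{\omega}$ is the smallest closed inverse submonoid that contains the image of $Y$, and a closed inverse submonoid is finitely generated if it has this form for a finite $Y$. For a closed inverse submonoid $H$, the coset graph $\Gamma_H$ has as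 vertices the right $\omega$-cosets $(Hm)^\omega=\{t : t\ge hm \text{ for some } h\in H\}$ with $mm^{-1}\in H$, and an edge labeled $x$ from $S$ to $T$ whenever $T=(Sx)^\omega$; the $\omega$-coset automaton of $H$ is $\Gamma_H$ with initial and terminal vertex $H$. The labeled $2$-complex $\mathcal C_H$ associated with $H$ has the vertices of $\Gamma_H$ as $0$-cells, the edges of $\Gamma_H$ labeled over $X$ as $1$-cells, and for each edge of $\Gamma_H$ labeled $\rho\in P$ one $2$-cell, labeled $\rho$, rooted at the initial vertex of that edge, whose boundary walk is the closed path at the root labeled $bl(\rho)$. (a) Every Schützenberger graph of $M_{X,P}$ is finite. There is an algorithm that, given a word $w$, outputs a finite description of the Schützenberger automaton of (the element represented by) $w$, up to isomorphism, and the word problem for $M_{X,P}$ is decidable. (b) If $H$ is a finitely generated closed inverse submonoid of $M_{X,P}$, then $\mathcal C_H$ is finite (it has finitely many cells). There is an algorithm that, given a finite list $Y$ of words, outputs a finite description of $\mathcal C_{\langle Y\rangle^\omega}$, up to isomorphism. Moreover, for a finite set $Y$ of words, let $\mathcal F(Y)$ be the flower automaton (a base point, which is the initial and the terminal vertex, with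 one closed path labeled $y$ attached for each $y\in Y$). An edge folding identifies two distinct edges with the same label and the same initial or the same terminal vertex. An expansion applies when some path from $a$ to $b$ is labeled by one side of a defining relation $\rho^2=\rho$ or $\rho=\rho\,bl(\rho)$ and no path from $a$ to $b$ is labeled by the other side; it adjoins a new path from $a$ to $b$ labeled by the other side. An automaton is complete if no edge folding and no expansion applies to it. Then: starting from $\mathcal F(Y)$, there is no infinite sequence of edge foldings and expansions in which expansions are made only when no edge folding is possible; some complete automaton is obtained from $\mathcal F(Y)$ by finitely many edge foldings and expansions; and every complete automaton so obtained is finite and isomorphic to the $\omega$-coset automaton of $\langle Y\rangle^\omega$. -/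

import Mathlib

namespace Immersions

/-! ### Inverse monoids -/

/-- An inverse monoid: every element `a` has a unique inverse, written `a⁻¹`. -/
class InverseMonoid (M : Type*) extends Monoid M, Inv M where
  mul_inv_mul' : ∀ a : M, a * a⁻¹ * a = a
  inv_mul_inv' : ∀ a : M, a⁻¹ * a * a⁻¹ = a⁻¹
  eq_inv' : ∀ a b : M, a * b * a = a → b * a * b = b → b = a⁻¹

namespace InverseMonoid

variable {M : Type*} [InverseMonoid M]

theorem inv_inv' (a : M) : (a⁻¹)⁻¹ = a :=
  (eq_inv' _ _ (inv_mul_inv' a) (mul_inv_mul' a)).symm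

theorem inv_idem {e : M} (he : e * e = e) : e⁻¹ = e :=
  (eq_inv' e e (by rw [he, he]) (by rw [he, he])).symm

theorem mul_idem_idem {e f : M} (he : e * e = e) (hf : f * f = f) : e * f * (e * f) = e * f := by
  have h1 := mul_inv_mul' (e * f)
  have h2 := inv_mul_inv' (e * f)
  set x := (e * f)⁻¹ with hx
  have key : f * x * e = x := by
    apply eq_inv'
    · calc e * f * (f * x * e) * (e * f) = e * (f * f) * x * (e * e) * f := by simp only [mul_assoc]
        _ = e * f * x * (e * f) := by rw [he, hf]; simp only [mul_assoc]
        _ = e * f := h1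
    · calc f * x * e * (e * f) * (f * x * e) = f * (x * ((e * e) * (f * f)) * x) * e := by
            simp only [mul_assoc]
        _ = f * x * e := by rw [he, hf, h2]
  have xid : x * x = x := by
    calc x * x = f * x * e * (f * x * e) := by rw [key]
      _ = f * (x * (e * f) * x) * e := by simp only [mul_assoc]
      _ = x := by rw [h2, key]
  have h3 : e * f = x := by
    have := inv_idem xid
    rw [hx, inv_inv'] at this
    exact this
  rw [h3, xid]

theorem idem_comm {e f : M} (he : e * e = e) (hf : f * f = f) : e * f = f * e := by
  have h1 := mul_idem_idem he hf
  have h2 := mul_idem_idem hf he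
  have : f * e = (e * f)⁻¹ := by
    apply eq_inv'
    · calc e * f * (f * e) * (e * f) = e * (f * f) * (e * e) * f := by simp only [mul_assoc]
        _ = e * f := by rw [he, hf, mul_assoc (e * f), h1]
    · calc f * e * (e * f) * (f * e) = f * (e * e) * (f * f) * e := by simp only [mul_assoc]
        _ = f * e := by rw [he, hf, mul_assoc (f * e), h2]
  rw [this, inv_idem h1]

theorem mul_inv_idem (a : M) : a * a⁻¹ * (a * a⁻¹) = a * a⁻¹ := by
  rw [← mul_assoc, mul_inv_mul']

theorem inv_mul_idem (a : M) : a⁻¹ * a * (a⁻¹ * a) = a⁻¹ * a := by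
  rw [← mul_assoc, inv_mul_inv']

theorem mul_inv_rev' (a b : M) : (a * b)⁻¹ = b⁻¹ * a⁻¹ := by
  symm
  have hc := idem_comm (mul_inv_idem b) (inv_mul_idem a)
  apply eq_inv'
  · calc a * b * (b⁻¹ * a⁻¹) * (a * b) = a * ((b * b⁻¹) * (a⁻¹ * a)) * b := by
          simp only [mul_assoc]
      _ = (a * a⁻¹ * a) * (b * b⁻¹ * b) := by rw [hc]; simp only [mul_assoc]
      _ = a * b := by rw [mul_inv_mul', mul_inv_mul']
  · calc b⁻¹ * a⁻¹ * (a * b) * (b⁻¹ * a⁻¹) = b⁻¹ * ((a⁻¹ * a) * (b * b⁻¹)) * a⁻¹ := by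
          simp only [mul_assoc]
      _ = (b⁻¹ * b * b⁻¹) * (a⁻¹ * a * a⁻¹) := by rw [← hc]; simp only [mul_assoc]
      _ = b⁻¹ * a⁻¹ := by rw [inv_mul_inv', inv_mul_inv']

/-- The natural partial order: `a ≤ b` iff `a = e * b` for some idempotent `e`. -/
def NatLE (a b : M) : Prop := ∃ e : M, e * e = e ∧ a = e * b

theorem NatLE.refl (a : M) : NatLE a a := ⟨1, by simp, by simp⟩

theorem NatLE.trans {a b c : M} (h : NatLE a b) (h' : NatLE b c) : NatLE a c := by
  obtain ⟨e, he, rfl⟩ := h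
  obtain ⟨f, hf, rfl⟩ := h'
  exact ⟨e * f, mul_idem_idem he hf, by rw [mul_assoc]⟩

theorem conj_idem (c : M) {e : M} (he : e * e = e) : c * e * c⁻¹ * (c * e * c⁻¹) = c * e * c⁻¹ := by
  calc c * e * c⁻¹ * (c * e * c⁻¹) = c * (e * (c⁻¹ * c)) * e * c⁻¹ := by simp only [mul_assoc]
    _ = (c * c⁻¹ * c) * (e * e) * c⁻¹ := by
      rw [idem_comm he (inv_mul_idem c)]; simp only [mul_assoc]
    _ = c * e * c⁻¹ := by rw [mul_inv_mul', he]

theorem mul_idem_eq (c : M) {e : M} (he : e * e = e) : c * e = c * e * c⁻¹ * c := by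
  calc c * e = (c * c⁻¹ * c) * e := by rw [mul_inv_mul']
    _ = c * ((c⁻¹ * c) * e) := by simp only [mul_assoc]
    _ = c * e * c⁻¹ * c := by rw [idem_comm (inv_mul_idem c) he]; simp only [mul_assoc]

theorem NatLE.mul_left {a b : M} (c : M) (h : NatLE a b) : NatLE (c * a) (c * b) := by
  obtain ⟨e, he, rfl⟩ := h
  exact ⟨c * e * c⁻¹, conj_idem c he, by
    rw [← mul_assoc, ← mul_assoc, ← mul_idem_eq c he]⟩

theorem NatLE.mul_right {a b : M} (c : M) (h : NatLE a b) : NatLE (a * c) (b * c) := by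
  obtain ⟨e, he, rfl⟩ := h
  exact ⟨e, he, by rw [mul_assoc]⟩

theorem natLE_mul_idem (a : M) {e : M} (he : e * e = e) : NatLE (a * e) a :=
  ⟨a * e * a⁻¹, conj_idem a he, mul_idem_eq a he⟩

/-- `S ^ ω`, the set of all elements above some element of `S`. -/
def upper (S : Set M) : Set M := {m | ∃ n ∈ S, NatLE n m}

end InverseMonoid

open InverseMonoid

/-- A closed inverse submonoid: a submonoid that is closed under inverses and upwards closed in
the natural partial order. -/
@[ext]
structure ClosedInverseSubmonoid (M : Type*) [InverseMonoid M] extends Submonoid M where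
  inv_mem' : ∀ {a : M}, a ∈ carrier → a⁻¹ ∈ carrier
  closed' : ∀ {a b : M}, a ∈ carrier → NatLE a b → b ∈ carrier

namespace ClosedInverseSubmonoid

variable {M : Type*} [InverseMonoid M]

/-- The closed inverse submonoid generated by a set: the smallest one that contains it. -/
def closure (S : Set M) : ClosedInverseSubmonoid M where
  carrier := {m | ∀ H : ClosedInverseSubmonoid M, S ⊆ H.carrier → m ∈ H.carrier}
  mul_mem' ha hb H hH := H.mul_mem' (ha H hH) (hb H hH)
  one_mem' H _ := H.one_mem'
  inv_mem' ha H hH := H.inv_mem' (ha H hH)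
  closed' ha hab H hH := H.closed' (ha H hH) hab

/-- Finitely generated as a closed inverse submonoid. -/
def FG (H : ClosedInverseSubmonoid M) : Prop := ∃ S : Set M, S.Finite ∧ H = closure S

/-- The right translate `H m`. -/
def translate (H : ClosedInverseSubmonoid M) (m : M) : Set M := (fun h => h * m) '' H.carrier

/-- The right `ω`-cosets of `H`: the sets `(H m) ^ ω` with `m * m⁻¹ ∈ H`. -/
def RightCoset (H : ClosedInverseSubmonoid M) : Type _ :=
  {S : Set M // ∃ m : M, m * m⁻¹ ∈ H.carrier ∧ S = upper (H.translate m)}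

/-- The coset `H = (H 1) ^ ω`. -/
def baseCoset (H : ClosedInverseSubmonoid M) : H.RightCoset :=
  ⟨H.carrier, 1, by
    rw [one_mul, inv_idem (mul_one (1 : M))]; exact H.one_mem', by
    ext m
    constructor
    · intro hm
      exact ⟨m, ⟨m, hm, mul_one m⟩, NatLE.refl m⟩
    · rintro ⟨n, ⟨h, hh, rfl⟩, hn⟩
      refine H.closed' hh ?_
      simpa using hn⟩

/-- The (partial) action of `M` on the right `ω`-cosets of `H`: `S · m = (S m) ^ ω` whenever the
latter is a right `ω`-coset of `H`. `H.Acts S m T` says that `S · m` is defined and equal to `T`. -/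
def Acts (H : ClosedInverseSubmonoid M) (S : H.RightCoset) (m : M) (T : H.RightCoset) : Prop :=
  T.1 = upper ((fun s => s * m) '' S.1)

theorem mem_upper_translate (H : ClosedInverseSubmonoid M) {a : M} (ha : a * a⁻¹ ∈ H.carrier)
    (m : M) : m ∈ upper (H.translate a) ↔ m * a⁻¹ ∈ H.carrier := by
  constructor
  · rintro ⟨n, ⟨h, hh, rfl⟩, hn⟩
    refine H.closed' (H.mul_mem' hh ha) ?_
    have := hn.mul_right a⁻¹
    simpa only [mul_assoc] using this
  · intro hm
    refine ⟨m * a⁻¹ * a, ⟨_, hm, rfl⟩, ?_⟩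
    rw [mul_assoc]
    exact natLE_mul_idem m (inv_mul_idem a)

theorem self_mem (H : ClosedInverseSubmonoid M) (a : M) : a ∈ upper (H.translate a) :=
  ⟨a, ⟨1, H.one_mem', one_mul a⟩, NatLE.refl a⟩

theorem upper_image (H : ClosedInverseSubmonoid M) (a m : M) :
    upper ((fun s => s * m) '' upper (H.translate a)) = upper (H.translate (a * m)) := by
  ext t
  constructor
  · rintro ⟨_, ⟨s, ⟨_, ⟨h, hh, rfl⟩, hs⟩, rfl⟩, ht⟩
    exact ⟨h * (a * m), ⟨h, hh, rfl⟩, by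
      have := (hs.mul_right m).trans ht
      rwa [mul_assoc] at this⟩
  · rintro ⟨_, ⟨h, hh, rfl⟩, ht⟩
    exact ⟨h * a * m, ⟨h * a, ⟨h * a, ⟨h, hh, rfl⟩, NatLE.refl _⟩, rfl⟩, by rwa [mul_assoc]⟩

theorem upper_translate_eq (H : ClosedInverseSubmonoid M) {a b : M} (ha : a * a⁻¹ ∈ H.carrier)
    (hb : b * b⁻¹ ∈ H.carrier) (hab : a * b⁻¹ ∈ H.carrier) :
    upper (H.translate a) = upper (H.translate b) := by
  have hba : b * a⁻¹ ∈ H.carrier := by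
    have := H.inv_mem' hab
    rwa [mul_inv_rev', inv_inv'] at this
  ext m
  rw [mem_upper_translate H ha, mem_upper_translate H hb]
  constructor
  · intro hm
    refine H.closed' (H.mul_mem' hm hab) ?_
    have := (natLE_mul_idem m (inv_mul_idem a)).mul_right b⁻¹
    simpa only [mul_assoc] using this
  · intro hm
    refine H.closed' (H.mul_mem' hm hba) ?_
    have := (natLE_mul_idem m (inv_mul_idem b)).mul_right a⁻¹
    simpa only [mul_assoc] using this

theorem mem_of_acts (H : ClosedInverseSubmonoid M) {a m : M} {S T : H.RightCoset}
    (hS : S.1 = upper (H.translate a)) (h : H.Acts S m T) :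
    a * m * (a * m)⁻¹ ∈ H.carrier ∧ T.1 = upper (H.translate (a * m)) := by
  unfold Acts at h
  rw [hS, upper_image] at h
  refine ⟨?_, h⟩
  obtain ⟨b, hb, hT⟩ := T.2
  have h1 : a * m ∈ upper (H.translate b) := by
    rw [← hT, h]; exact H.self_mem _
  rw [mem_upper_translate H hb] at h1
  have h2 := H.mul_mem' h1 (H.inv_mem' h1)
  refine H.closed' h2 ?_
  rw [mul_inv_rev', inv_inv']
  have := (natLE_mul_idem (a * m) (inv_mul_idem b)).mul_right (a * m)⁻¹
  simpa only [mul_assoc] using this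

theorem acts_symm (H : ClosedInverseSubmonoid M) {m : M} {S T : H.RightCoset}
    (h : H.Acts S m T) : H.Acts T m⁻¹ S := by
  obtain ⟨a, ha, hS⟩ := S.2
  obtain ⟨h1, hT⟩ := H.mem_of_acts hS h
  unfold Acts
  rw [hT, upper_image, hS]
  have e : a * m * m⁻¹ * (a * m * m⁻¹)⁻¹ = a * m * (a * m)⁻¹ := by
    simp only [mul_inv_rev', inv_inv']
    calc a * m * m⁻¹ * (m * (m⁻¹ * a⁻¹)) = a * (m * m⁻¹ * m) * m⁻¹ * a⁻¹ := by
          simp only [mul_assoc]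
      _ = _ := by rw [mul_inv_mul']; simp only [mul_assoc]
  refine H.upper_translate_eq ha (by rw [e]; exact h1) ?_
  have : a * (a * m * m⁻¹)⁻¹ = a * m * (a * m)⁻¹ := by
    simp only [mul_inv_rev', inv_inv', mul_assoc]
  rw [this]; exact h1

theorem acts_inv_iff (H : ClosedInverseSubmonoid M) {m : M} {S T : H.RightCoset} :
    H.Acts S m T ↔ H.Acts T m⁻¹ S :=
  ⟨H.acts_symm, fun h => by simpa only [inv_inv'] using H.acts_symm h⟩

end ClosedInverseSubmonoid

/-! ### Words and presentations of inverse monoids -/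

/-- Words over `A ∪ A⁻¹`: the letter `(a, true)` is `a`, the letter `(a, false)` is `a⁻¹`.
The inverse of a word `w` is `FreeGroup.invRev w`. -/
abbrev Word (A : Type*) : Type _ := List (A × Bool)

/-- The inverse of a letter. -/
def invLetter {A : Type*} (x : A × Bool) : A × Bool := (x.1, !x.2)

/-- The defining relations of `Inv⟨A | R⟩` on the free monoid with involution. -/
inductive PresentationRel {A : Type*} (R : Word A → Word A → Prop) :
    FreeMonoid (A × Bool) → FreeMonoid (A × Bool) → Prop
  | regular (w : Word A) : PresentationRel R
      (FreeMonoid.ofList (w ++ FreeGroup.invRev w ++ w)) (FreeMonoid.ofList w)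
  | commute (u w : Word A) : PresentationRel R
      (FreeMonoid.ofList (w ++ FreeGroup.invRev w ++ (u ++ FreeGroup.invRev u)))
      (FreeMonoid.ofList (u ++ FreeGroup.invRev u ++ (w ++ FreeGroup.invRev w)))
  | rel (u v : Word A) : R u v → PresentationRel R (FreeMonoid.ofList u) (FreeMonoid.ofList v)

/-- The inverse monoid `Inv⟨A | u = v for R u v⟩`. -/
def InvPresentation {A : Type*} (R : Word A → Word A → Prop) : Type _ :=
  (conGen (PresentationRel R)).Quotient

namespace InvPresentation

variable {A : Type*} {R : Word A → Word A → Prop}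

instance instMonoid : Monoid (InvPresentation R) :=
  inferInstanceAs (Monoid (conGen (PresentationRel R)).Quotient)

/-- The element of `Inv⟨A | R⟩` represented by a word. -/
def mk (R : Word A → Word A → Prop) (w : Word A) : InvPresentation R :=
  (conGen (PresentationRel R)).mk' (FreeMonoid.ofList w)

theorem mk_append (u v : Word A) : mk R (u ++ v) = mk R u * mk R v := by
  simp only [mk, FreeMonoid.ofList_append, map_mul]
  rfl

theorem mk_nil : mk R [] = 1 := rfl

theorem mk_surjective : Function.Surjective (mk R) := fun m => by
  obtain ⟨w, hw⟩ := Con.mk'_surjective (c := conGen (PresentationRel R)) m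
  exact ⟨FreeMonoid.toList w, hw⟩

theorem mk_eq_of_rel {u v : Word A}
    (h : PresentationRel R (FreeMonoid.ofList u) (FreeMonoid.ofList v)) : mk R u = mk R v :=
  (Con.eq _).2 (ConGen.Rel.of _ _ h)

theorem mk_eq_iff {u v : Word A} :
    mk R u = mk R v ↔ conGen (PresentationRel R) (FreeMonoid.ofList u) (FreeMonoid.ofList v) :=
  Con.eq _

theorem mk_regular (w : Word A) : mk R w * mk R (FreeGroup.invRev w) * mk R w = mk R w := by
  rw [← mk_append, ← mk_append]; exact mk_eq_of_rel (.regular w)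

theorem mk_regular' (w : Word A) :
    mk R (FreeGroup.invRev w) * mk R w * mk R (FreeGroup.invRev w) =
      mk R (FreeGroup.invRev w) := by
  have := mk_regular (R := R) (FreeGroup.invRev w)
  rwa [FreeGroup.invRev_invRev] at this

theorem mk_commute (u w : Word A) :
    mk R w * mk R (FreeGroup.invRev w) * (mk R u * mk R (FreeGroup.invRev u)) =
      mk R u * mk R (FreeGroup.invRev u) * (mk R w * mk R (FreeGroup.invRev w)) := by
  simp only [← mk_append]; exact mk_eq_of_rel (.commute u w)

theorem invRev_append (u v : Word A) :
    FreeGroup.invRev (u ++ v) = FreeGroup.invRev v ++ FreeGroup.invRev u := by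
  simp [FreeGroup.invRev]

theorem mk_invRev_eq_of_eq {u v : Word A} (h : mk R u = mk R v) :
    mk R (FreeGroup.invRev u) = mk R (FreeGroup.invRev v) := by
  have c1 := mk_commute (R := R) (FreeGroup.invRev u) (FreeGroup.invRev v)
  have c2 := mk_commute (R := R) u v
  have r1 := mk_regular' (R := R) u
  have r2 := mk_regular' (R := R) v
  have r3 := mk_regular (R := R) u
  have r4 := mk_regular (R := R) v
  rw [FreeGroup.invRev_invRev, FreeGroup.invRev_invRev] at c1
  rw [← h] at c1 c2 r2 r4
  set a := mk R u
  set b := mk R (FreeGroup.invRev u)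
  set c := mk R (FreeGroup.invRev v)
  calc b = b * (a * c * a) * b := by rw [r4, r1]
    _ = (b * a) * (c * a) * b := by simp only [mul_assoc]
    _ = c * a * (b * a) * b := by rw [c1]
    _ = c * a * (b * a * b) := by simp only [mul_assoc]
    _ = c * a * b := by rw [r1]
    _ = c * a * c * a * b := by rw [r2]
    _ = c * (a * c * (a * b)) := by simp only [mul_assoc]
    _ = c * (a * b * a) * c := by rw [c2]; simp only [mul_assoc]
    _ = c := by rw [r3, r2]

/-- Inversion in `Inv⟨A | R⟩`, induced by the involution on words. -/
def inv : InvPresentation R → InvPresentation R :=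
  Quotient.lift (fun w : FreeMonoid (A × Bool) => mk R (FreeGroup.invRev (FreeMonoid.toList w)))
    fun _ _ h => mk_invRev_eq_of_eq ((Con.eq _).2 h)

instance instInv : Inv (InvPresentation R) := ⟨inv⟩

theorem mk_inv (w : Word A) : (mk R w)⁻¹ = mk R (FreeGroup.invRev w) := rfl

theorem idem_eq {e : InvPresentation R} (he : e * e = e) : e = e * e⁻¹ ∧ e⁻¹ = e := by
  obtain ⟨w, rfl⟩ := mk_surjective e
  rw [mk_inv]
  have he' : mk R (FreeGroup.invRev w) * mk R (FreeGroup.invRev w) = mk R (FreeGroup.invRev w) := by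
    rw [← mk_append, ← invRev_append]
    exact mk_invRev_eq_of_eq (by rw [mk_append, he])
  have c := mk_commute (R := R) (FreeGroup.invRev w) w
  have r1 := mk_regular (R := R) w
  have r2 := mk_regular' (R := R) w
  rw [FreeGroup.invRev_invRev] at c
  set a := mk R w
  set b := mk R (FreeGroup.invRev w)
  have h : a = b := by
    calc a = a * (b * b) * a := by rw [he', r1]
      _ = a * b * (b * a) := by simp only [mul_assoc]
      _ = b * (a * a) * b := by rw [c]; simp only [mul_assoc]
      _ = b := by rw [he, r2]
  rw [← h, he]
  exact ⟨rfl, rfl⟩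

theorem idem_comm {e f : InvPresentation R} (he : e * e = e) (hf : f * f = f) :
    e * f = f * e := by
  rw [(idem_eq he).1, (idem_eq hf).1]
  obtain ⟨w, rfl⟩ := mk_surjective e
  obtain ⟨u, rfl⟩ := mk_surjective f
  exact mk_commute u w

instance instInverseMonoid : InverseMonoid (InvPresentation R) where
  mul_inv_mul' a := by
    obtain ⟨w, rfl⟩ := mk_surjective a
    exact mk_regular w
  inv_mul_inv' a := by
    obtain ⟨w, rfl⟩ := mk_surjective a
    exact mk_regular' w
  eq_inv' a b h1 h2 := by
    have r1 : a * a⁻¹ * a = a := by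
      obtain ⟨w, rfl⟩ := mk_surjective a
      exact mk_regular w
    have r2 : a⁻¹ * a * a⁻¹ = a⁻¹ := by
      obtain ⟨w, rfl⟩ := mk_surjective a
      exact mk_regular' w
    set c := a⁻¹
    have i1 : b * a * (b * a) = b * a := by rw [← mul_assoc, h2]
    have i2 : c * a * (c * a) = c * a := by rw [← mul_assoc, r2]
    have i3 : a * b * (a * b) = a * b := by rw [← mul_assoc, h1]
    have i4 : a * c * (a * c) = a * c := by rw [← mul_assoc, r1]
    calc b = b * (a * c * a) * b := by rw [r1, h2]
      _ = (b * a) * (c * a) * b := by simp only [mul_assoc]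
      _ = c * a * (b * a) * b := by rw [idem_comm i1 i2]
      _ = c * a * (b * a * b) := by simp only [mul_assoc]
      _ = c * a * b := by rw [h2]
      _ = c * a * c * a * b := by rw [r2]
      _ = c * (a * c * (a * b)) := by simp only [mul_assoc]
      _ = c * (a * b * a) * c := by rw [idem_comm i4 i3]; simp only [mul_assoc]
      _ = c := by rw [h1, r2]

end InvPresentation

/-! ### Labeled graphs and birooted graphs (automata) -/

/-- Digraphs with edges labeled over `A ∪ A⁻¹`, consistently with the involution. The edges are
given as a set of triples `(initial vertex, label, terminal vertex)`. -/
structure LabeledGraph.{u, v} (A : Type u) where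
  V : Type v
  edge : V → A × Bool → V → Prop
  edge_inv : ∀ u x v, edge u x v → edge v (invLetter x) u

namespace LabeledGraph

variable {A : Type*}

/-- `G.Path u w v`: there is a path from `u` to `v` labeled by the word `w`. -/
def Path (G : LabeledGraph A) : G.V → Word A → G.V → Prop
  | u, [], v => u = v
  | u, x :: w, v => ∃ t, G.edge u x t ∧ Path G t w v

theorem Path.append {G : LabeledGraph A} : ∀ {u v t : G.V} {w w' : Word A},
    G.Path u w v → G.Path v w' t → G.Path u (w ++ w') t
  | _, _, _, [], _, rfl, h' => h'
  | _, _, _, _ :: _, _, ⟨s, hs, h⟩, h' => ⟨s, hs, Path.append h h'⟩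

theorem Path.symm {G : LabeledGraph A} : ∀ {u v : G.V} {w : Word A},
    G.Path u w v → ∃ w', G.Path v w' u
  | _, _, [], rfl => ⟨[], rfl⟩
  | u, _, x :: _, ⟨_, hs, h⟩ => by
    obtain ⟨w', h'⟩ := Path.symm h
    exact ⟨w' ++ [invLetter x], h'.append ⟨u, G.edge_inv _ _ _ hs, rfl⟩⟩

/-- At most one edge with a given label starts at a given vertex (and hence, by consistency with
the involution, at most one edge with a given label ends there). -/
def Deterministic (G : LabeledGraph A) : Prop :=
  ∀ u x v v', G.edge u x v → G.edge u x v' → v = v'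

/-- Any two vertices are joined by a path, and there is at least one vertex. -/
def Connected (G : LabeledGraph A) : Prop :=
  Nonempty G.V ∧ ∀ u v, ∃ w, G.Path u w v

/-- The positively labeled edges. -/
def PosEdge (G : LabeledGraph A) : Type _ :=
  {t : G.V × A × G.V // G.edge t.1 (t.2.1, true) t.2.2}

/-- Finitely many vertices and finitely many edges. -/
def IsFinite (G : LabeledGraph A) : Prop := Finite G.V ∧ Finite G.PosEdge

/-- Identify vertices along a relation; the edges are the images of the edges. -/
def quot (G : LabeledGraph A) (r : G.V → G.V → Prop) : LabeledGraph A where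
  V := Quot r
  edge p x q := ∃ u v, Quot.mk r u = p ∧ Quot.mk r v = q ∧ G.edge u x v
  edge_inv := by
    rintro _ x _ ⟨u, v, rfl, rfl, h⟩
    exact ⟨v, u, rfl, rfl, G.edge_inv _ _ _ h⟩

/-- Disjoint union of two graphs. -/
def sum (G H : LabeledGraph A) : LabeledGraph A where
  V := G.V ⊕ H.V
  edge p x q := (∃ u v, p = Sum.inl u ∧ q = Sum.inl v ∧ G.edge u x v) ∨
    (∃ u v, p = Sum.inr u ∧ q = Sum.inr v ∧ H.edge u x v)
  edge_inv := by
    rintro _ x _ (⟨u, v, rfl, rfl, h⟩ | ⟨u, v, rfl, rfl, h⟩)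
    · exact Or.inl ⟨v, u, rfl, rfl, G.edge_inv _ _ _ h⟩
    · exact Or.inr ⟨v, u, rfl, rfl, H.edge_inv _ _ _ h⟩

/-- Disjoint union of a family of graphs. -/
def sigma {ι : Type*} (G : ι → LabeledGraph A) : LabeledGraph A where
  V := Σ i, (G i).V
  edge p x q := ∃ i u v, p = ⟨i, u⟩ ∧ q = ⟨i, v⟩ ∧ (G i).edge u x v
  edge_inv := by
    rintro _ x _ ⟨i, u, v, rfl, rfl, h⟩
    exact ⟨i, v, u, rfl, rfl, (G i).edge_inv _ _ _ h⟩

/-- The linear graph of a word `w`: vertices `0, …, |w|`, with the path from `0` to `|w|` labeled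
by `w`, and the inverse edges. -/
def line (w : Word A) : LabeledGraph A where
  V := Fin (w.length + 1)
  edge p x q := ∃ i : Fin w.length,
    (p = i.castSucc ∧ q = i.succ ∧ x = w.get i) ∨
    (p = i.succ ∧ q = i.castSucc ∧ x = invLetter (w.get i))
  edge_inv := by
    rintro _ x _ ⟨i, ⟨rfl, rfl, rfl⟩ | ⟨rfl, rfl, rfl⟩⟩
    · exact ⟨i, Or.inr ⟨rfl, rfl, rfl⟩⟩
    · exact ⟨i, Or.inl ⟨rfl, rfl, by simp [invLetter]⟩⟩

end LabeledGraph

/-- Labeled graphs with an initial and a terminal vertex, viewed as automata. -/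
structure Automaton (A : Type*) extends LabeledGraph A where
  initial : V
  terminal : V

namespace Automaton

variable {A : Type*}

/-- Isomorphism of birooted labeled graphs. -/
def Iso (B C : Automaton A) : Prop :=
  ∃ f : B.V ≃ C.V, (∀ u x v, B.edge u x v ↔ C.edge (f u) x (f v)) ∧
    f B.initial = C.initial ∧ f B.terminal = C.terminal

/-- Identify the vertices `q` and `r` (and hence any two edges that become equal). -/
def fold (B : Automaton A) (q r : B.V) : Automaton A where
  toLabeledGraph := B.toLabeledGraph.quot fun s t => s = q ∧ t = r
  initial := Quot.mk _ B.initial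
  terminal := Quot.mk _ B.terminal

/-- Adjoin a new path labeled `v` from the vertex `a` to the vertex `b`. -/
def adjoinPath (B : Automaton A) (a : B.V) (v : Word A) (b : B.V) : Automaton A where
  toLabeledGraph := (B.toLabeledGraph.sum (LabeledGraph.line v)).quot fun s t =>
    (s = Sum.inl a ∧ t = Sum.inr (0 : Fin (v.length + 1))) ∨
    (s = Sum.inl b ∧ t = Sum.inr (Fin.last v.length))
  initial := Quot.mk _ (Sum.inl B.initial)
  terminal := Quot.mk _ (Sum.inl B.terminal)

/-- An edge folding: two distinct edges with the same label and the same initial vertex are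
identified. (Two edges with the same label and the same terminal vertex are covered through their
inverse edges.) -/
inductive Folding : Automaton A → Automaton A → Prop
  | mk (B : Automaton A) (p : B.V) (x : A × Bool) (q r : B.V) :
      B.edge p x q → B.edge p x r → q ≠ r → Folding B (B.fold q r)

/-- An expansion with respect to the relations `R`: if there is a path from `a` to `b` labeled by
one side of a relation, but none labeled by the other side, then such a path is adjoined. -/
inductive Expansion (R : Word A → Word A → Prop) : Automaton A → Automaton A → Prop
  | mk (B : Automaton A) (a b : B.V) (u v : Word A) :
      R u v ∨ R v u → B.Path a u b → ¬ B.Path a v b → Expansion R B (B.adjoinPath a v b)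

/-- One step of the procedure: an edge folding or an expansion. -/
def Step (R : Word A → Word A → Prop) (B C : Automaton A) : Prop :=
  Folding B C ∨ Expansion R B C

/-- One step of the procedure in which foldings take precedence: an expansion is made only if no
edge folding is possible. -/
def FoldFirstStep (R : Word A → Word A → Prop) (B C : Automaton A) : Prop :=
  Folding B C ∨ (B.Deterministic ∧ Expansion R B C)

/-- `C` is obtained from `B` by finitely many edge foldings and expansions. -/
def Reaches (R : Word A → Word A → Prop) : Automaton A → Automaton A → Prop :=
  Relation.ReflTransGen (Step R)

/-- No edge folding and no expansion can be applied. -/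
def Complete (R : Word A → Word A → Prop) (B : Automaton A) : Prop := ∀ C, ¬ Step R B C

/-- The flower automaton of a set `Y` of words: a base point, which is the initial and the terminal
vertex, and for each `y ∈ Y` a closed path at the base point labeled by `y`. The base point is
the only vertex of the linear graph of the empty word. -/
def flower (Y : Set (Word A)) : Automaton A where
  toLabeledGraph :=
    ((LabeledGraph.line ([] : Word A)).sum
      (LabeledGraph.sigma fun y : Y => LabeledGraph.line y.1)).quot fun s t =>
        s = Sum.inl (0 : Fin 1) ∧ ∃ y : Y,
          t = Sum.inr ⟨y, (0 : Fin (y.1.length + 1))⟩ ∨ t = Sum.inr ⟨y, Fin.last y.1.length⟩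
  initial := Quot.mk _ (Sum.inl (0 : Fin 1))
  terminal := Quot.mk _ (Sum.inl (0 : Fin 1))

end Automaton

/-- The Schützenberger automaton of an element `m` of `Inv⟨A | R⟩`: the vertices are the elements of
the `𝓡`-class of `m`, the edges are those of the Cayley graph, the roots are `m m⁻¹` and `m`. -/
def schutzenbergerAutomaton {A : Type*} {R : Word A → Word A → Prop} (m : InvPresentation R) :
    Automaton A where
  V := {u : InvPresentation R // u * u⁻¹ = m * m⁻¹}
  edge u x v := u.1 * InvPresentation.mk R [x] = v.1
  edge_inv := by
    rintro ⟨u, hu⟩ x ⟨v, hv⟩ h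
    dsimp only at h ⊢
    have hx : InvPresentation.mk R [invLetter x] = (InvPresentation.mk R [x])⁻¹ := rfl
    rw [hx]
    set y := InvPresentation.mk R [x]
    subst h
    have h1 : u * y * y⁻¹ * u⁻¹ = u * u⁻¹ := by
      rw [mul_inv_rev'] at hv
      rw [hu, ← hv]; simp only [mul_assoc]
    calc u * y * y⁻¹ = u * u⁻¹ * u * (y * y⁻¹) := by rw [mul_inv_mul', mul_assoc]
      _ = u * ((u⁻¹ * u) * (y * y⁻¹)) := by simp only [mul_assoc]
      _ = u * y * y⁻¹ * u⁻¹ * u := by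
        rw [InverseMonoid.idem_comm (inv_mul_idem u) (mul_inv_idem y)]; simp only [mul_assoc]
      _ = u := by rw [h1, mul_inv_mul']
  initial := ⟨m * m⁻¹, by
    rw [inv_idem (mul_inv_idem m), mul_inv_idem]⟩
  terminal := ⟨m, rfl⟩

/-- The `ω`-coset automaton `(H, Γ_H, H)` of a closed inverse submonoid of `Inv⟨A | R⟩`. -/
def cosetAutomaton {A : Type*} {R : Word A → Word A → Prop}
    (H : ClosedInverseSubmonoid (InvPresentation R)) : Automaton A where
  V := H.RightCoset
  edge S x T := H.Acts S (InvPresentation.mk R [x]) T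
  edge_inv _ _ _ h := H.acts_symm h
  initial := H.baseCoset
  terminal := H.baseCoset

/-! ### The inverse monoid `M_{X,P}` -/

/-- A word over `X ∪ X⁻¹`, read as a word over the larger alphabet `X ∪ P` and its inverses. -/
def liftWord {X : Type*} (P : Type*) (w : Word X) : Word (X ⊕ P) :=
  w.map fun x => (Sum.inl x.1, x.2)

/-- The one-letter word `ρ`. -/
def cellWord (X : Type*) {P : Type*} (ρ : P) : Word (X ⊕ P) := [(Sum.inr ρ, true)]

/-- The defining relations `ρ² = ρ` and `ρ = ρ bl(ρ)` of `M_{X,P}`, where `bl ρ` is the boundary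
label of the `2`-cell `ρ`. -/
inductive CellRel {X P : Type*} (bl : P → Word X) : Word (X ⊕ P) → Word (X ⊕ P) → Prop
  | idem (ρ : P) : CellRel bl (cellWord X ρ ++ cellWord X ρ) (cellWord X ρ)
  | boundary (ρ : P) : CellRel bl (cellWord X ρ) (cellWord X ρ ++ liftWord P (bl ρ))

/-- `M_{X,P} = Inv⟨X ∪ P | ρ² = ρ, ρ ≤ bl(ρ)⟩`. -/
abbrev MXP {X P : Type*} (bl : P → Word X) : Type _ := InvPresentation (CellRel bl)

/-- The element of `M_{X,P}` represented by a word. -/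
abbrev MXP.mk {X P : Type*} (bl : P → Word X) (w : Word (X ⊕ P)) : MXP bl :=
  InvPresentation.mk (CellRel bl) w

/-! ### Labeled 2-complexes -/

/-- Connected `2`-complexes labeled over `X` and `P` (combinatorially): the labeling is the one
induced by an immersion into the complex `B_{X,P}` with one `0`-cell, the `1`-cells `X`, and the
`2`-cells `ρ ∈ P` attached along `bl ρ`. The `0`-cells and `1`-cells are the vertices and the
positively labeled edges of `skeleton`. Being deterministic, the `1`-skeleton contains at most one
path with a given initial vertex and a given label, so the boundary walk of a `2`-cell `c` is the
path that starts at its root and is labeled by `bl (label c)`; it has to be a closed path. That the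
map to `B_{X,P}` is locally injective is expressed by `deterministic` and `cell_inj`. -/
structure LabeledTwoComplex.{u, v, w, z} {X : Type u} {P : Type v} (bl : P → Word X) where
  skeleton : LabeledGraph.{u, w} X
  Cell : Type z
  root : Cell → skeleton.V
  label : Cell → P
  connected : skeleton.Connected
  deterministic : skeleton.Deterministic
  cell_inj : ∀ c c', label c = label c' → root c = root c' → c = c'
  boundary : ∀ c, skeleton.Path (root c) (bl (label c)) (root c)

/-- Finitely many `0`-cells, `1`-cells and `2`-cells. -/
def LabeledTwoComplex.IsFinite {X P : Type*} {bl : P → Word X} (C : LabeledTwoComplex bl) : Prop :=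
  C.skeleton.IsFinite ∧ Finite C.Cell

/-- The subgraph of the edges with labels in `X ∪ X⁻¹`. -/
def LabeledGraph.restrictLeft {X P : Type*} (G : LabeledGraph (X ⊕ P)) : LabeledGraph X where
  V := G.V
  edge u x v := G.edge u (Sum.inl x.1, x.2) v
  edge_inv _ _ _ h := G.edge_inv _ _ _ h

theorem LabeledGraph.restrictLeft_path {X P : Type*} (G : LabeledGraph (X ⊕ P)) :
    ∀ (w : Word X) (u v : G.V), G.Path u (liftWord P w) v → G.restrictLeft.Path u w v
  | [], _, _, h => h
  | _ :: w, _, _, ⟨t, ht, h⟩ => ⟨t, ht, G.restrictLeft_path w t _ h⟩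

section CosetComplex

variable {A : Type*} {R : Word A → Word A → Prop} (H : ClosedInverseSubmonoid (InvPresentation R))

theorem coset_prefix_mem {a u v : InvPresentation R}
    (h : a * (u * v) * (a * (u * v))⁻¹ ∈ H.carrier) : a * u * (a * u)⁻¹ ∈ H.carrier := by
  refine H.closed' h ?_
  have := (natLE_mul_idem (a * u) (mul_inv_idem v)).mul_right (a * u)⁻¹
  simpa only [mul_inv_rev', mul_assoc] using this

/-- The coset `(H a) ^ ω`. -/
def mkCoset (a : InvPresentation R) (ha : a * a⁻¹ ∈ H.carrier) : H.RightCoset :=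
  ⟨_, a, ha, rfl⟩

theorem coset_path (w : Word A) : ∀ (a : InvPresentation R) (S T : H.RightCoset),
    S.1 = upper (H.translate a) → T.1 = upper (H.translate (a * InvPresentation.mk R w)) →
    a * InvPresentation.mk R w * (a * InvPresentation.mk R w)⁻¹ ∈ H.carrier →
    (cosetAutomaton H).Path S w T := by
  induction w with
  | nil =>
    intro a S T hS hT _
    rw [InvPresentation.mk_nil, mul_one, ← hS] at hT
    exact Subtype.ext hT.symm
  | cons x w ih =>
    intro a S T hS hT h
    have e : InvPresentation.mk R (x :: w) = InvPresentation.mk R [x] * InvPresentation.mk R w := by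
      rw [← InvPresentation.mk_append]; rfl
    rw [e] at h hT
    refine ⟨mkCoset H (a * InvPresentation.mk R [x]) (coset_prefix_mem H h), ?_, ?_⟩
    · change upper _ = upper _
      rw [hS, H.upper_image]
    · exact ih (a * InvPresentation.mk R [x]) _ T rfl (by rw [hT, mul_assoc])
        (by rw [mul_assoc a]; exact h)

theorem base_path (T : H.RightCoset) : ∃ w, (cosetAutomaton H).Path H.baseCoset w T := by
  obtain ⟨m, hm, hT⟩ := T.2
  obtain ⟨w, rfl⟩ := InvPresentation.mk_surjective m
  refine ⟨w, coset_path H w 1 _ _ ?_ (by rw [one_mul]; exact hT) (by rw [one_mul]; exact hm)⟩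
  ext m
  constructor
  · intro hm
    exact ⟨m, ⟨m, hm, mul_one m⟩, NatLE.refl m⟩
  · rintro ⟨n, ⟨h, hh, rfl⟩, hn⟩
    refine H.closed' hh ?_
    simpa using hn

theorem cosetAutomaton_deterministic : (cosetAutomaton H).Deterministic :=
  fun _ _ _ _ h h' => Subtype.ext (Eq.trans h (Eq.symm h'))

end CosetComplex

section CosetComplex

variable {X P : Type*} {bl : P → Word X} (H : ClosedInverseSubmonoid (MXP bl))

theorem cell_idem (ρ : P) :
    MXP.mk bl (cellWord X ρ) * MXP.mk bl (cellWord X ρ) = MXP.mk bl (cellWord X ρ) := by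
  rw [← InvPresentation.mk_append]
  exact InvPresentation.mk_eq_of_rel (.rel _ _ (.idem ρ))

theorem cell_boundary (ρ : P) :
    MXP.mk bl (cellWord X ρ) = MXP.mk bl (cellWord X ρ) * MXP.mk bl (liftWord P (bl ρ)) := by
  rw [← InvPresentation.mk_append]
  exact InvPresentation.mk_eq_of_rel (.rel _ _ (.boundary ρ))

theorem coset_cell {S T : H.RightCoset} {ρ : P}
    (h : (cosetAutomaton H).edge S (Sum.inr ρ, true) T) :
    S = T ∧ (cosetAutomaton H).Path S (liftWord P (bl ρ)) S := by
  obtain ⟨a, ha, hS⟩ := S.2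
  obtain ⟨h1, hT⟩ := H.mem_of_acts hS h
  have hid := cell_idem (bl := bl) ρ
  have hinv : (MXP.mk bl (cellWord X ρ))⁻¹ = MXP.mk bl (cellWord X ρ) := inv_idem hid
  have hb := cell_boundary (bl := bl) ρ
  change a * MXP.mk bl (cellWord X ρ) * (a * MXP.mk bl (cellWord X ρ))⁻¹ ∈ H.carrier at h1
  change T.1 = upper (H.translate (a * MXP.mk bl (cellWord X ρ))) at hT
  set r := MXP.mk bl (cellWord X ρ)
  set b := MXP.mk bl (liftWord P (bl ρ)) with hbdef
  have h2 : a * r * a⁻¹ ∈ H.carrier := by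
    have e : a * r * (a * r)⁻¹ = a * r * a⁻¹ := by
      rw [mul_inv_rev', hinv]
      calc a * r * (r * a⁻¹) = a * (r * r) * a⁻¹ := by simp only [mul_assoc]
        _ = _ := by rw [hid]
    rwa [e] at h1
  have h3 : a * b * (a * b)⁻¹ ∈ H.carrier := by
    refine H.closed' h1 ?_
    have hle : NatLE (a * r) (a * b) :=
      NatLE.mul_left a ⟨r, hid, hb⟩
    have e : a * r * (a * r)⁻¹ = a * r * a⁻¹ * (a * b * (a * b)⁻¹) := by
      simp only [mul_inv_rev']
      calc a * r * (r⁻¹ * a⁻¹) = a * (r * r⁻¹) * a⁻¹ := by simp only [mul_assoc]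
        _ = a * ((r * b) * (r * b)⁻¹) * a⁻¹ := by rw [← hb]
        _ = a * (r * (b * b⁻¹) * r) * a⁻¹ := by
          rw [mul_inv_rev', hinv]; simp only [mul_assoc]
        _ = a * ((b * b⁻¹) * (r * r)) * a⁻¹ := by
          rw [InverseMonoid.idem_comm hid (mul_inv_idem b)]; simp only [mul_assoc]
        _ = a * (r * (b * b⁻¹)) * a⁻¹ := by
          rw [hid, InverseMonoid.idem_comm hid (mul_inv_idem b)]
        _ = (a * a⁻¹ * a) * (r * (b * b⁻¹)) * a⁻¹ := by rw [mul_inv_mul']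
        _ = a * ((a⁻¹ * a) * r) * (b * b⁻¹) * a⁻¹ := by simp only [mul_assoc]
        _ = a * r * a⁻¹ * (a * b * (b⁻¹ * a⁻¹)) := by
          rw [InverseMonoid.idem_comm (inv_mul_idem a) hid]; simp only [mul_assoc]
    rw [e]
    exact ⟨a * r * a⁻¹, conj_idem a hid, rfl⟩
  have h4 : a * b * a⁻¹ ∈ H.carrier := by
    refine H.closed' h2 ?_
    exact (NatLE.mul_left a ⟨r, hid, hb⟩).mul_right a⁻¹
  constructor
  · apply Subtype.ext
    rw [hT, hS]
    refine (H.upper_translate_eq h1 ha ?_).symm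
    exact h2
  · refine coset_path H _ a S S hS ?_ h3
    rw [hS]
    exact (H.upper_translate_eq h3 ha h4).symm

theorem coset_restrict_path : ∀ (w : Word (X ⊕ P)) (S T : H.RightCoset),
    (cosetAutomaton H).Path S w T → ∃ w', (cosetAutomaton H).restrictLeft.Path S w' T
  | [], _, _, h => ⟨[], h⟩
  | (Sum.inl x, s) :: w, _, T, ⟨t, ht, h⟩ => by
    obtain ⟨w', h'⟩ := coset_restrict_path w t T h
    exact ⟨(x, s) :: w', t, ht, h'⟩
  | (Sum.inr ρ, true) :: w, _, T, ⟨t, ht, h⟩ => by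
    obtain rfl := (coset_cell H ht).1
    exact coset_restrict_path w _ T h
  | (Sum.inr ρ, false) :: w, _, T, ⟨t, ht, h⟩ => by
    obtain rfl := (coset_cell H ((cosetAutomaton H).edge_inv _ _ _ ht)).1
    exact coset_restrict_path w _ T h

/-- The coset complex `C_H`: the `0`-cells are the vertices of `Γ_H`, the `1`-cells are the edges
labeled over `X`, and each edge `e` labeled by some `ρ ∈ P` is replaced by a `2`-cell with label `ρ`,
rooted at the initial vertex of `e`, with boundary walk labeled by `bl ρ`. -/
def cosetComplex : LabeledTwoComplex bl where
  skeleton := (cosetAutomaton H).restrictLeft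
  Cell := {t : H.RightCoset × P × H.RightCoset //
    (cosetAutomaton H).edge t.1 (Sum.inr t.2.1, true) t.2.2}
  root c := c.1.1
  label c := c.1.2.1
  connected := ⟨⟨H.baseCoset⟩, fun S T => by
    obtain ⟨w, hw⟩ := base_path H S
    obtain ⟨w', hw'⟩ := coset_restrict_path H w _ _ hw
    obtain ⟨u, hu⟩ := hw'.symm
    obtain ⟨v, hv⟩ := base_path H T
    obtain ⟨v', hv'⟩ := coset_restrict_path H v _ _ hv
    exact ⟨_, hu.append hv'⟩⟩
  deterministic _ _ _ _ h h' := cosetAutomaton_deterministic H _ _ _ _ h h'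
  cell_inj := by
    rintro ⟨⟨S, ρ, T⟩, h⟩ ⟨⟨S', ρ', T'⟩, h'⟩ hl hr
    dsimp only at hl hr h h'
    subst hl; subst hr
    obtain rfl := cosetAutomaton_deterministic H _ _ _ _ h h'
    rfl
  boundary c := LabeledGraph.restrictLeft_path _ _ _ _ (coset_cell H c.2).2

end CosetComplex

/-! ### Finite descriptions, for effective constructibility -/

/-- A finite description of an automaton: the number `n` of vertices (which are `0, …, n - 1`), the
list of positively labeled edges, the initial vertex and the terminal vertex. -/
abbrev AutomatonCode (A : Type*) : Type _ := ℕ × List (ℕ × A × ℕ) × ℕ × ℕ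

/-- The finite description `c` describes an automaton isomorphic to `B`. -/
def AutomatonCode.Describes {A : Type*} (c : AutomatonCode A) (B : Automaton A) : Prop :=
  ∃ f : Fin c.1 ≃ B.V,
    (∀ p a q, (p, a, q) ∈ c.2.1 ↔
      ∃ (hp : p < c.1) (hq : q < c.1), B.edge (f ⟨p, hp⟩) (a, true) (f ⟨q, hq⟩)) ∧
    (f.symm B.initial : ℕ) = c.2.2.1 ∧ (f.symm B.terminal : ℕ) = c.2.2.2

/-- A finite description of a labeled `2`-complex: the number `n` of `0`-cells (which are
`0, …, n - 1`), the list of `1`-cells (initial vertex, label, terminal vertex), and the list of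
`2`-cells (root, label). -/
abbrev ComplexCode (X P : Type*) : Type _ := ℕ × List (ℕ × X × ℕ) × List (ℕ × P)

/-- The finite description `c` describes a labeled `2`-complex isomorphic to `C`. -/
def ComplexCode.Describes {X P : Type*} {bl : P → Word X} (c : ComplexCode X P)
    (C : LabeledTwoComplex bl) : Prop :=
  ∃ f : Fin c.1 ≃ C.skeleton.V,
    (∀ p x q, (p, x, q) ∈ c.2.1 ↔
      ∃ (hp : p < c.1) (hq : q < c.1), C.skeleton.edge (f ⟨p, hp⟩) (x, true) (f ⟨q, hq⟩)) ∧
    (∀ p ρ, (p, ρ) ∈ c.2.2 ↔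
      ∃ (hp : p < c.1) (d : C.Cell), C.root d = f ⟨p, hp⟩ ∧ C.label d = ρ)

end Immersions

open Immersions

namespace Immersions

open InverseMonoid FreeGroup

/-! ### Paths, morphisms and isomorphisms of labeled graphs -/

namespace LabeledGraph

variable {A : Type*}

theorem path_append_iff {G : LabeledGraph A} {v : G.V} {w' : Word A} : ∀ {w : Word A} {u : G.V},
    G.Path u (w ++ w') v ↔ ∃ t, G.Path u w t ∧ G.Path t w' v
  | [], u => ⟨fun h => ⟨u, rfl, h⟩, by rintro ⟨_, rfl, h⟩; exact h⟩
  | x :: w, u => by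
    simp only [List.cons_append, Path, path_append_iff (w := w)]
    exact ⟨fun ⟨s, hs, t, h, h'⟩ => ⟨t, ⟨s, hs, h⟩, h'⟩, fun ⟨t, ⟨s, hs, h⟩, h'⟩ => ⟨s, hs, t, h, h'⟩⟩

theorem path_singleton {G : LabeledGraph A} {u v : G.V} {x : A × Bool} :
    G.Path u [x] v ↔ G.edge u x v :=
  ⟨by rintro ⟨_, h, rfl⟩; exact h, fun h => ⟨v, h, rfl⟩⟩

theorem Path.invRev {G : LabeledGraph A} {v : G.V} : ∀ {w : Word A} {u : G.V},
    G.Path u w v → G.Path v (invRev w) u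
  | [], _, h => Eq.symm h
  | x :: w, u, ⟨s, hs, h⟩ => by
    rw [invRev_cons]
    exact h.invRev.append (path_singleton.2 (G.edge_inv _ _ _ hs))

theorem path_invRev_iff {G : LabeledGraph A} {u v : G.V} {w : Word A} :
    G.Path v (FreeGroup.invRev w) u ↔ G.Path u w v :=
  ⟨fun h => by simpa only [invRev_invRev] using h.invRev, Path.invRev⟩

theorem Deterministic.path_unique {G : LabeledGraph A} (hG : G.Deterministic) {v v' : G.V} :
    ∀ {w : Word A} {u : G.V}, G.Path u w v → G.Path u w v' → v = v'
  | [], _, h, h' => Eq.trans (Eq.symm h) h'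
  | _ :: _, _, ⟨_, hs, h⟩, ⟨_, hs', h'⟩ => by
    obtain rfl := hG _ _ _ _ hs hs'
    exact hG.path_unique h h'

/-- A map of vertices that preserves labeled edges. -/
def IsHom (G H : LabeledGraph A) (f : G.V → H.V) : Prop :=
  ∀ u x v, G.edge u x v → H.edge (f u) x (f v)

theorem IsHom.path {G H : LabeledGraph A} {f : G.V → H.V} (hf : G.IsHom H f) {v : G.V} :
    ∀ {w : Word A} {u : G.V}, G.Path u w v → H.Path (f u) w (f v)
  | [], _, h => congrArg f h
  | _ :: _, _, ⟨_, hs, h⟩ => ⟨_, hf _ _ _ hs, hf.path h⟩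

theorem IsHom.comp {G H K : LabeledGraph A} {f : G.V → H.V} {g : H.V → K.V}
    (hg : H.IsHom K g) (hf : G.IsHom H f) : G.IsHom K (g ∘ f) :=
  fun _ _ _ h => hg _ _ _ (hf _ _ _ h)

/-- Every vertex is joined to `p` by a path. -/
def ReachableFrom (G : LabeledGraph A) (p : G.V) : Prop := ∀ q, ∃ w, G.Path p w q

/-- Two labels `u`, `v` lead from the base point to a common vertex exactly when `u v⁻¹` labels a
closed path there, so equal sets of closed paths transfer this relation. The case `u = v` shows that
the same words can be read from both base points. -/
theorem exists_map_of_loops {G H : LabeledGraph A} (hG : G.Deterministic) (hH : H.Deterministic)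
    {p : G.V} {p' : H.V} (hp : G.ReachableFrom p)
    (hl : ∀ w, G.Path p w p ↔ H.Path p' w p') :
    ∃ f : G.V → H.V, ∀ w q, G.Path p w q ↔ H.Path p' w (f q) := by
  choose c hc using hp
  have key : ∀ u v, (∃ q, G.Path p u q ∧ G.Path p v q) ↔ ∃ q, H.Path p' u q ∧ H.Path p' v q := by
    intro u v
    have := hl (u ++ FreeGroup.invRev v)
    simpa only [path_append_iff, path_invRev_iff] using this
  have h1 : ∀ q, ∃ q', H.Path p' (c q) q' := fun q => by
    obtain ⟨q', h, -⟩ := (key (c q) (c q)).1 ⟨q, hc q, hc q⟩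
    exact ⟨q', h⟩
  choose f hf using h1
  refine ⟨f, fun w q => ⟨fun h => ?_, fun h => ?_⟩⟩
  · obtain ⟨q', h1, h2⟩ := (key w (c q)).1 ⟨q, h, hc q⟩
    rwa [hH.path_unique (hf q) h2]
  · obtain ⟨q', h1, h2⟩ := (key w (c q)).2 ⟨f q, h, hf q⟩
    rwa [hG.path_unique (hc q) h2]

/-- Deterministic graphs are determined up to isomorphism by the labels of the closed paths at a
vertex from which all vertices can be reached. -/
theorem exists_equiv_of_loops {G H : LabeledGraph A} (hG : G.Deterministic)
    (hH : H.Deterministic) {p : G.V} {p' : H.V} (hp : G.ReachableFrom p)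
    (hp' : H.ReachableFrom p') (hl : ∀ w, G.Path p w p ↔ H.Path p' w p') :
    ∃ f : G.V ≃ H.V, f p = p' ∧ (∀ w q, G.Path p w q ↔ H.Path p' w (f q)) ∧
      ∀ u x v, G.edge u x v ↔ H.edge (f u) x (f v) := by
  obtain ⟨f, hf⟩ := exists_map_of_loops hG hH hp hl
  obtain ⟨g, hg⟩ := exists_map_of_loops hH hG hp' fun w => (hl w).symm
  have hgf : ∀ q, g (f q) = q := fun q => by
    obtain ⟨w, hw⟩ := hp q
    exact hG.path_unique ((hg _ _).1 ((hf _ _).1 hw)) hw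
  have hfg : ∀ q, f (g q) = q := fun q => by
    obtain ⟨w, hw⟩ := hp' q
    exact hH.path_unique ((hf _ _).1 ((hg _ _).1 hw)) hw
  refine ⟨⟨f, g, hgf, hfg⟩, ?_, hf, fun u x v => ?_⟩
  · exact Eq.symm ((hf [] p).1 rfl)
  -- An edge out of `u` is the last edge of a path from the base point, so the statement about
  -- paths, applied to `w ++ [x]`, yields the one about edges.
  · obtain ⟨w, hw⟩ := hp u
    have hw' := (hf w u).1 hw
    have h := hf (w ++ [x]) v
    simp only [path_append_iff, path_singleton] at h
    constructor
    · intro e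
      obtain ⟨t, ht, he⟩ := h.1 ⟨u, hw, e⟩
      rwa [← hH.path_unique hw' ht] at he
    · intro e
      obtain ⟨t, ht, he⟩ := h.2 ⟨f u, hw', e⟩
      rwa [← hG.path_unique hw ht] at he

end LabeledGraph

theorem InverseMonoid.NatLE.inv {M : Type*} [InverseMonoid M] {a b : M} (h : NatLE a b) :
    NatLE a⁻¹ b⁻¹ := by
  obtain ⟨e, he, rfl⟩ := h
  rw [mul_inv_rev', inv_idem he]
  exact natLE_mul_idem _ he

/-! ### Rewriting words of a closed inverse submonoid of `M_{X,P}` -/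

/-- One-way rewriting rules that increase the represented element of `M_{X,P}`. -/
inductive Rewrite {X P : Type*} (bl : P → Word X) : Word (X ⊕ P) → Word (X ⊕ P) → Prop
  | cancel (x : (X ⊕ P) × Bool) : Rewrite bl [x, invLetter x] []
  | erase (ρ : P) (b : Bool) : Rewrite bl [(Sum.inr ρ, b)] []
  | boundary (ρ : P) : Rewrite bl [(Sum.inr ρ, true)] (liftWord P (bl ρ))
  | boundary_inv (ρ : P) : Rewrite bl [(Sum.inr ρ, false)] (invRev (liftWord P (bl ρ)))

/-- The words obtained from products of words in `Y ∪ Y⁻¹` by the rules `Rewrite bl`. -/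
inductive Derivable {X P : Type*} (bl : P → Word X) (Y : Set (Word (X ⊕ P))) :
    Word (X ⊕ P) → Prop
  | nil : Derivable bl Y []
  | mul {w y : Word (X ⊕ P)} : Derivable bl Y w → y ∈ Y → Derivable bl Y (w ++ y)
  | mul_inv {w y : Word (X ⊕ P)} : Derivable bl Y w → y ∈ Y → Derivable bl Y (w ++ invRev y)
  | rewrite (u : Word (X ⊕ P)) {m m' : Word (X ⊕ P)} (v : Word (X ⊕ P)) : Rewrite bl m m' →
      Derivable bl Y (u ++ m ++ v) → Derivable bl Y (u ++ m' ++ v)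

section Rewriting

variable {X P : Type*} {bl : P → Word X}

theorem mk_singleton_invLetter {A : Type*} {R : Word A → Word A → Prop} (x : A × Bool) :
    InvPresentation.mk R [invLetter x] = (InvPresentation.mk R [x])⁻¹ := rfl

/-- Soundness of the rules: a closed submonoid is upwards closed, so rewriting cannot leave it. -/
theorem Rewrite.natLE {m m' : Word (X ⊕ P)} (h : Rewrite bl m m') :
    NatLE (MXP.mk bl m) (MXP.mk bl m') := by
  have hinv : ∀ ρ, MXP.mk bl [(Sum.inr ρ, false)] = (MXP.mk bl (cellWord X ρ))⁻¹ := fun _ => rfl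
  cases h with
  | cancel x =>
    have : MXP.mk bl [x, invLetter x] = MXP.mk bl [x] * (MXP.mk bl [x])⁻¹ := by
      rw [← mk_singleton_invLetter, ← InvPresentation.mk_append]; rfl
    exact ⟨_, mul_inv_idem (MXP.mk bl [x]), by
      rw [this, MXP.mk, MXP.mk, InvPresentation.mk_nil, mul_one]⟩
  | erase ρ b =>
    refine ⟨MXP.mk bl (cellWord X ρ), cell_idem ρ, ?_⟩
    change _ = _ * 1
    rw [mul_one]
    cases b
    · rw [hinv, inv_idem (cell_idem ρ)]
    · rfl
  | boundary ρ => exact ⟨_, cell_idem ρ, cell_boundary ρ⟩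
  | boundary_inv ρ =>
    exact NatLE.inv ⟨_, cell_idem ρ, cell_boundary ρ⟩

theorem Rewrite.invRev {m m' : Word (X ⊕ P)} (h : Rewrite bl m m') :
    Rewrite bl (invRev m) (invRev m') := by
  cases h with
  | cancel x =>
    have : FreeGroup.invRev [x, invLetter x] = [x, invLetter x] := by
      simp [FreeGroup.invRev, invLetter]
    rw [this]; exact .cancel x
  | erase ρ b => exact .erase ρ (!b)
  | boundary ρ => exact .boundary_inv ρ
  | boundary_inv ρ => rw [invRev_invRev]; exact .boundary ρ

namespace Derivable

variable {Y : Set (Word (X ⊕ P))}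

theorem append {w w' : Word (X ⊕ P)} (h : Derivable bl Y w) (h' : Derivable bl Y w') :
    Derivable bl Y (w ++ w') := by
  induction h' with
  | nil => rwa [List.append_nil]
  | mul _ hy ih => rw [← List.append_assoc]; exact ih.mul hy
  | mul_inv _ hy ih => rw [← List.append_assoc]; exact ih.mul_inv hy
  | rewrite u v hr _ ih =>
    have := Derivable.rewrite (w ++ u) v hr (by simpa only [List.append_assoc] using ih)
    simpa only [List.append_assoc] using this

theorem invRev {w : Word (X ⊕ P)} (h : Derivable bl Y w) :
    Derivable bl Y (FreeGroup.invRev w) := by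
  induction h with
  | nil => exact .nil
  | mul _ hy ih =>
    rw [invRev_append]; exact append (by simpa using Derivable.nil.mul_inv hy) ih
  | mul_inv _ hy ih =>
    rw [invRev_append, invRev_invRev]; exact append (by simpa using Derivable.nil.mul hy) ih
  | rewrite u v hr _ ih =>
    simp only [invRev_append, ← List.append_assoc] at ih ⊢
    exact ih.rewrite _ _ hr.invRev

theorem cancel (w : Word (X ⊕ P)) : ∀ {u v : Word (X ⊕ P)},
    Derivable bl Y (u ++ (w ++ (FreeGroup.invRev w ++ v))) → Derivable bl Y (u ++ v) := by
  induction w with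
  | nil => exact fun h => h
  | cons x w ih =>
    intro u v h
    rw [invRev_cons] at h
    have h1 : Derivable bl Y ((u ++ [x]) ++ (FreeGroup.invRev [x] ++ v)) :=
      ih (by simpa only [List.append_assoc, List.cons_append, List.nil_append] using h)
    have h2 : Derivable bl Y (u ++ [x, invLetter x] ++ v) := by
      simpa [FreeGroup.invRev, invLetter] using h1
    simpa using h2.rewrite _ _ (.cancel x)

theorem cancel' (w : Word (X ⊕ P)) {u v : Word (X ⊕ P)}
    (h : Derivable bl Y (u ++ (FreeGroup.invRev w ++ (w ++ v)))) : Derivable bl Y (u ++ v) :=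
  cancel (FreeGroup.invRev w) (by rwa [invRev_invRev])

/-- The product `st (s't)⁻¹ s't'` equals `s t t⁻¹ s'⁻¹ s' t'` as a word and cancels to `st'`. It
lets one-way rules be undone. -/
theorem exchange {s s' t t' : Word (X ⊕ P)} (h1 : Derivable bl Y (s ++ t))
    (h2 : Derivable bl Y (s' ++ t)) (h3 : Derivable bl Y (s' ++ t')) :
    Derivable bl Y (s ++ t') := by
  have h := (h1.append h2.invRev).append h3
  simp only [invRev_append, List.append_assoc] at h
  exact cancel' s' (cancel t h)

/-- Words that can be replaced by each other inside derivable words. -/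
def con (bl : P → Word X) (Y : Set (Word (X ⊕ P))) : Con (FreeMonoid ((X ⊕ P) × Bool)) where
  r a b := ∀ u v : Word (X ⊕ P),
    Derivable bl Y (u ++ (FreeMonoid.toList a ++ v)) ↔ Derivable bl Y (u ++ (FreeMonoid.toList b ++ v))
  iseqv := ⟨fun _ _ _ => Iff.rfl, fun h u v => (h u v).symm, fun h h' u v => (h u v).trans (h' u v)⟩
  mul' {a b c d} h h' u v := by
    have h1 := h u (FreeMonoid.toList c ++ v)
    have h2 := h' (u ++ FreeMonoid.toList b) v
    simp only [FreeMonoid.toList_mul, List.append_assoc] at h1 h2 ⊢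
    exact h1.trans h2

/-- One direction of most relations is a direct use of the rules; the insertions come from
multiplying derivable words by each other and cancelling. -/
theorem presentationRel_con {a b : FreeMonoid ((X ⊕ P) × Bool)}
    (h : PresentationRel (CellRel bl) a b) : con bl Y a b := by
  intro u v
  cases h with
  | regular w =>
    simp only [FreeMonoid.toList_ofList, List.append_assoc]
    refine ⟨fun h => cancel w h, fun h => ?_⟩
    -- With `h` for `u w v`, this is `u w v v⁻¹ w⁻¹ u⁻¹ u w v`; cancelling `v v⁻¹` and `u⁻¹ u`
    -- leaves `u w w⁻¹ w v`.
    have := (h.append h.invRev).append h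
    simp only [invRev_append, List.append_assoc] at this
    simpa only [List.append_assoc] using cancel' (u := u ++ (w ++ FreeGroup.invRev w)) u
      (by simpa only [List.append_assoc] using cancel (u := u ++ w) v (by
        simpa only [List.append_assoc] using this))
  | commute a b =>
    have key : ∀ a b : Word (X ⊕ P), Derivable bl Y
        (u ++ (b ++ (FreeGroup.invRev b ++ (a ++ (FreeGroup.invRev a ++ v))))) → Derivable bl Y
        (u ++ (a ++ (FreeGroup.invRev a ++ (b ++ (FreeGroup.invRev b ++ v))))) := by
      intro a b h
      have h1 := cancel b h
      have h2 : Derivable bl Y (u ++ (b ++ (FreeGroup.invRev b ++ v))) := by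
        have := cancel (u := u ++ (b ++ FreeGroup.invRev b)) a
          (by simpa only [List.append_assoc] using h)
        simpa only [List.append_assoc] using this
      -- Here `s' = u` and `t' = b b⁻¹ v`: the words `u a a⁻¹ v`, `u v` and `u b b⁻¹ v` are
      -- combined.
      have := exchange (s := u ++ (a ++ FreeGroup.invRev a)) (t := v)
        (by simpa only [List.append_assoc] using h1) (cancel a h1) h2
      simpa only [List.append_assoc] using this
    simp only [FreeMonoid.toList_ofList, List.append_assoc]
    exact ⟨key a b, key b a⟩
  | rel a b hr =>
    have erase : ∀ {u ρ v}, Derivable bl Y (u ++ (cellWord X ρ ++ v)) → Derivable bl Y (u ++ v) :=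
      fun {u ρ v} h => by
        simpa using Derivable.rewrite u v (.erase ρ true) (by simpa [cellWord] using h)
    have bdry : ∀ {u ρ v}, Derivable bl Y (u ++ (cellWord X ρ ++ v)) →
        Derivable bl Y (u ++ (liftWord P (bl ρ) ++ v)) := fun {u ρ v} h => by
      simpa using Derivable.rewrite u v (.boundary ρ) (by simpa [cellWord] using h)
    simp only [FreeMonoid.toList_ofList]
    cases hr with
    | idem ρ =>
      simp only [List.append_assoc]
      refine ⟨erase, fun h => ?_⟩
      -- From `u ρ v`, `u v` and `u ρ v`, with `t' = ρ v`, the second `ρ` is inserted.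
      have := exchange (s := u ++ cellWord X ρ) (by rwa [List.append_assoc]) (erase h) h
      rwa [List.append_assoc] at this
    | boundary ρ =>
      simp only [List.append_assoc]
      refine ⟨fun h => ?_, fun h => ?_⟩
      · have := exchange (s := u ++ cellWord X ρ) (by rwa [List.append_assoc]) (erase h) (bdry h)
        rwa [List.append_assoc] at this
      -- With `β = bl ρ`: from `(u ρ)(β v)`, `(u β)(β v)` and `(u β) v` one gets `u ρ v`, so `β` is
      -- removed after `ρ` although no rule does this.
      · have := exchange (s := u ++ cellWord X ρ) (s' := u ++ liftWord P (bl ρ)) (t' := v)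
          (by rwa [List.append_assoc]) (by simpa only [List.append_assoc] using bdry h)
          (by simpa only [List.append_assoc] using erase h)
        rwa [List.append_assoc] at this

/-- Equality in `M_{X,P}` is the least congruence containing the presentation relations, and
replaceability inside derivable words is a congruence containing them. -/
theorem of_mk_eq {w w' : Word (X ⊕ P)} (h : MXP.mk bl w = MXP.mk bl w')
    (hw : Derivable bl Y w) : Derivable bl Y w' := by
  have h1 : conGen (PresentationRel (CellRel bl)) ≤ con bl Y :=
    Con.conGen_le.2 fun _ _ h => presentationRel_con h
  have := (h1 (InvPresentation.mk_eq_iff.1 h) [] []).1 (by simpa using hw)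
  simpa using this

theorem mk_mem {w : Word (X ⊕ P)} (h : Derivable bl Y w) {H : ClosedInverseSubmonoid (MXP bl)}
    (hY : MXP.mk bl '' Y ⊆ H.carrier) : MXP.mk bl w ∈ H.carrier := by
  induction h with
  | nil => exact H.one_mem'
  | mul _ hy ih =>
    rw [MXP.mk, InvPresentation.mk_append]; exact H.mul_mem' ih (hY ⟨_, hy, rfl⟩)
  | mul_inv _ hy ih =>
    rw [MXP.mk, InvPresentation.mk_append, ← InvPresentation.mk_inv]
    exact H.mul_mem' ih (H.inv_mem' (hY ⟨_, hy, rfl⟩))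
  | rewrite u v hr _ ih =>
    refine H.closed' ih ?_
    simp only [InvPresentation.mk_append]
    exact (hr.natLE.mul_left _).mul_right _

/-- The elements represented by derivable words. -/
def closedInverseSubmonoid (bl : P → Word X) (Y : Set (Word (X ⊕ P))) :
    ClosedInverseSubmonoid (MXP bl) where
  carrier := {m | ∃ w, MXP.mk bl w = m ∧ Derivable bl Y w}
  mul_mem' := by
    rintro _ _ ⟨w, rfl, h⟩ ⟨w', rfl, h'⟩
    exact ⟨w ++ w', InvPresentation.mk_append _ _, h.append h'⟩
  one_mem' := ⟨[], rfl, .nil⟩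
  inv_mem' := by
    rintro _ ⟨w, rfl, h⟩
    exact ⟨_, rfl, h.invRev⟩
  closed' := by
    rintro _ b ⟨w, rfl, h⟩ ⟨e, he, hw⟩
    obtain ⟨w', rfl⟩ := InvPresentation.mk_surjective b
    obtain ⟨z, rfl⟩ := InvPresentation.mk_surjective e
    -- The idempotent is written as `z z⁻¹`, so `w` equals `z z⁻¹ w'` in the monoid and the rule
    -- `cancel` produces `w'`.
    rw [(InvPresentation.idem_eq he).1, InvPresentation.mk_inv, ← InvPresentation.mk_append,
      ← InvPresentation.mk_append] at hw
    refine ⟨w', rfl, ?_⟩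
    have := h.of_mk_eq hw
    rw [List.append_assoc] at this
    exact cancel (u := []) z this

end Derivable

/-- Derivable words form a closed inverse submonoid containing `Y`, and the rules are sound; hence
it is the smallest one. -/
theorem mk_mem_closure_iff {Y : Set (Word (X ⊕ P))} {w : Word (X ⊕ P)} :
    MXP.mk bl w ∈ (ClosedInverseSubmonoid.closure (MXP.mk bl '' Y)).carrier ↔
      Derivable bl Y w := by
  constructor
  · intro h
    obtain ⟨w', hw, h'⟩ := h (Derivable.closedInverseSubmonoid bl Y) (by
      rintro _ ⟨y, hy, rfl⟩
      exact ⟨y, rfl, by simpa using Derivable.nil.mul hy⟩)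
    exact h'.of_mk_eq hw
  · exact fun h H hH => h.mk_mem hH

/-- A graph in which every path can be rewritten by the rules `Rewrite bl`. -/
def LabeledGraph.RewriteClosed (bl : P → Word X) (G : LabeledGraph (X ⊕ P)) : Prop :=
  ∀ u m m' v, Rewrite bl m m' → G.Path u m v → G.Path u m' v

/-- Two edges labeled `x` at `u` give a path labeled `x⁻¹ x` between their ends, and cancelling it
makes the ends equal. -/
theorem LabeledGraph.RewriteClosed.deterministic {G : LabeledGraph (X ⊕ P)}
    (hG : G.RewriteClosed bl) : G.Deterministic := by
  intro u x v v' h h'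
  have := hG v _ _ v' (.cancel (invLetter x))
    ⟨u, G.edge_inv _ _ _ h, v', by simpa [invLetter] using h', rfl⟩
  exact this

theorem Derivable.path {G : LabeledGraph (X ⊕ P)} (hG : G.RewriteClosed bl) {p : G.V}
    {Y : Set (Word (X ⊕ P))} (hY : ∀ y ∈ Y, G.Path p y p) {w : Word (X ⊕ P)}
    (h : Derivable bl Y w) : G.Path p w p := by
  induction h with
  | nil => rfl
  | mul _ hy ih => exact ih.append (hY _ hy)
  | mul_inv _ hy ih => exact ih.append (hY _ hy).invRev
  | rewrite u v hr _ ih =>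
    simp only [LabeledGraph.path_append_iff] at ih ⊢
    obtain ⟨s, ⟨t, h1, h2⟩, h3⟩ := ih
    exact ⟨s, ⟨t, h1, hG _ _ _ _ hr h2⟩, h3⟩

end Rewriting

/-! ### The coset automaton and the Schützenberger automaton -/

section CosetAutomaton

variable {A : Type*} {R : Word A → Word A → Prop} {H : ClosedInverseSubmonoid (InvPresentation R)}

theorem coset_path_spec {w : Word A} : ∀ {a : InvPresentation R} {S T : H.RightCoset},
    (cosetAutomaton H).Path S w T → a * a⁻¹ ∈ H.carrier → S.1 = upper (H.translate a) →
    a * InvPresentation.mk R w * (a * InvPresentation.mk R w)⁻¹ ∈ H.carrier ∧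
      T.1 = upper (H.translate (a * InvPresentation.mk R w)) := by
  induction w with
  | nil =>
    intro a S T h ha hS
    rw [InvPresentation.mk_nil, mul_one]
    obtain rfl : S = T := h
    exact ⟨ha, hS⟩
  | cons x w ih =>
    rintro a S T ⟨S', hx, h⟩ ha hS
    have e : InvPresentation.mk R (x :: w) = InvPresentation.mk R [x] * InvPresentation.mk R w := by
      rw [← InvPresentation.mk_append]; rfl
    obtain ⟨ha', hS'⟩ := H.mem_of_acts hS hx
    rw [e, ← mul_assoc]
    exact ih h ha' hS'

/-- If `S` is the coset of `a`, the path ends at the coset of `au`. Since `au ≤ av`, closedness puts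
`au (av)⁻¹` and `av (av)⁻¹` into `H`, so `v` can be read from `S` and `av` represents the same coset
as `au`. -/
theorem coset_path_of_natLE {u v : Word A}
    (huv : NatLE (InvPresentation.mk R u) (InvPresentation.mk R v)) {S T : H.RightCoset}
    (h : (cosetAutomaton H).Path S u T) : (cosetAutomaton H).Path S v T := by
  obtain ⟨a, ha, hS⟩ := S.2
  obtain ⟨hu, hT⟩ := coset_path_spec h ha hS
  have hle := huv.mul_left a
  have huv' := H.closed' hu (hle.inv.mul_left _)
  have hv := H.closed' huv' (hle.mul_right _)
  exact coset_path H v a S T hS (by rw [hT, H.upper_translate_eq hu hv huv']) hv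

theorem baseCoset_eq : H.baseCoset.1 = upper (H.translate 1) := by
  ext m
  constructor
  · intro hm
    exact ⟨m, ⟨m, hm, mul_one m⟩, NatLE.refl m⟩
  · rintro ⟨n, ⟨h, hh, rfl⟩, hn⟩
    exact H.closed' hh (by simpa using hn)

theorem coset_loop_iff {w : Word A} :
    (cosetAutomaton H).Path H.baseCoset w H.baseCoset ↔ InvPresentation.mk R w ∈ H.carrier := by
  have h1 : (1 : InvPresentation R) * 1⁻¹ ∈ H.carrier := by
    rw [one_mul]; exact H.inv_mem' H.one_mem'
  constructor
  · intro h
    have h2 := (coset_path_spec h h1 baseCoset_eq).2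
    rw [one_mul] at h2
    have h3 := H.self_mem (InvPresentation.mk R w)
    rwa [← h2] at h3
  · intro h
    have h2 := H.mul_mem' h (H.inv_mem' h)
    refine coset_path H w 1 _ _ baseCoset_eq ?_ (by rwa [one_mul])
    rw [one_mul, baseCoset_eq]
    exact H.upper_translate_eq h1 h2 (by rw [one_mul]; exact H.inv_mem' h)

theorem coset_reachable : (cosetAutomaton H).ReachableFrom H.baseCoset := base_path H

end CosetAutomaton

theorem coset_rewriteClosed {X P : Type*} {bl : P → Word X}
    (H : ClosedInverseSubmonoid (MXP bl)) : (cosetAutomaton H).RewriteClosed bl :=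
  fun _ _ _ _ h => coset_path_of_natLE h.natLE

/-! ### Schützenberger graphs and the natural partial order -/

section Schutzenberger

variable {A : Type*} {R : Word A → Word A → Prop}

theorem schutzenberger_deterministic (m : InvPresentation R) :
    (schutzenbergerAutomaton m).Deterministic :=
  fun _ _ _ _ h h' => Subtype.ext (Eq.trans (Eq.symm h) h')

/-- If right multiplication by `xy` stays in the `𝓡`-class of `u`, so does multiplication by the
prefix `x`. Thus a word whose product ends in the `𝓡`-class labels a path inside the Schützenberger
graph. -/
theorem mul_inv_eq_of_mul_mul {M : Type*} [InverseMonoid M] {u x y : M}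
    (h : u * x * y * (u * x * y)⁻¹ = u * u⁻¹) : u * x * (u * x)⁻¹ = u * u⁻¹ := by
  have h1 : u * x * (u * x)⁻¹ * (u * u⁻¹) = u * u⁻¹ := by
    rw [← h, ← mul_assoc, ← mul_assoc (u * x * (u * x)⁻¹), mul_inv_mul']
  have h2 : u * u⁻¹ * (u * x * (u * x)⁻¹) = u * x * (u * x)⁻¹ := by
    rw [← mul_assoc, ← mul_assoc, mul_inv_mul']
  rw [← h2, InverseMonoid.idem_comm (mul_inv_idem u) (mul_inv_idem (u * x)), h1]

theorem schutzenberger_path_iff {m : InvPresentation R} {w : Word A} :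
    ∀ {u v : (schutzenbergerAutomaton m).V},
      (schutzenbergerAutomaton m).Path u w v ↔ u.1 * InvPresentation.mk R w = v.1 := by
  induction w with
  | nil =>
    intro u v
    rw [InvPresentation.mk_nil, mul_one]
    exact Subtype.ext_iff
  | cons x w ih =>
    intro u v
    have e : InvPresentation.mk R (x :: w) = InvPresentation.mk R [x] * InvPresentation.mk R w := by
      rw [← InvPresentation.mk_append]; rfl
    rw [e, ← mul_assoc]
    constructor
    · rintro ⟨t, ht, h⟩
      rw [← ih.1 h]
      exact congrArg (· * _) ht
    · intro h
      have hu := u.2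
      have hv := v.2
      rw [← h] at hv
      exact ⟨⟨_, (mul_inv_eq_of_mul_mul (hv.trans hu.symm)).trans hu⟩, rfl, ih.2 h⟩

theorem schutzenberger_reachable (m : InvPresentation R) :
    (schutzenbergerAutomaton m).ReachableFrom (schutzenbergerAutomaton m).initial := by
  rintro ⟨u, hu⟩
  obtain ⟨w, rfl⟩ := InvPresentation.mk_surjective u
  refine ⟨w, schutzenberger_path_iff.2 ?_⟩
  change m * m⁻¹ * InvPresentation.mk R w = InvPresentation.mk R w
  rw [← hu, mul_inv_mul']

/-- The elements above an idempotent. -/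
def aboveIdem {M : Type*} [InverseMonoid M] (e : M) (he : e * e = e) :
    ClosedInverseSubmonoid M where
  carrier := {t | e * t = e}
  mul_mem' {a b} ha hb := by
    change e * (a * b) = e
    rw [← mul_assoc, show e * a = e from ha]; exact hb
  one_mem' := mul_one e
  inv_mem' {t} (ht : e * t = e) := by
    change e * t⁻¹ = e
    have h1 : e * t⁻¹ = e * (t * t⁻¹) := by rw [← mul_assoc, ht]
    have h2 : e * t⁻¹ = t * e := by
      have := inv_idem (mul_idem_idem he (mul_inv_idem t))
      rw [← h1, mul_inv_rev', inv_inv', inv_idem he] at this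
      exact this.symm
    have h3 : e * t⁻¹ * t = e := by rw [h1, mul_assoc, mul_inv_mul', ht]
    calc e * t⁻¹ = e * t⁻¹ * (e * t⁻¹) := by
          rw [h1, mul_idem_idem he (mul_inv_idem t)]
      _ = e * t⁻¹ * t * e := by rw [h2, ← mul_assoc]
      _ = e := by rw [h3, he]
  closed' {a b} (ha : e * a = e) := by
    rintro ⟨g, hg, rfl⟩
    change e * b = e
    have h1 : g * (e * b) = e := by
      rw [← mul_assoc, ← InverseMonoid.idem_comm he hg, mul_assoc, ha]
    have h2 : g * e = e := by
      conv_lhs => rw [← h1, ← mul_assoc, hg]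
      exact h1
    calc e * b = g * e * b := by rw [h2]
      _ = e := by rw [mul_assoc, h1]

/-- The closed submonoid generated by an idempotent is just the set of elements above it. -/
theorem mem_closure_idem_iff {M : Type*} [InverseMonoid M] {e t : M} (he : e * e = e) :
    t ∈ (ClosedInverseSubmonoid.closure {e}).carrier ↔ e * t = e := by
  constructor
  · intro h
    exact h (aboveIdem e he) (by rintro _ rfl; exact he)
  · intro h H hH
    exact H.closed' (hH rfl) ⟨e, he, h.symm⟩

/-- Together with `coset_loop_iff` this makes the Schützenberger graph of `m` and the coset graph of
the up-set of `m m⁻¹` share their closed paths, so that one construction serves both. -/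
theorem schutzenberger_loop_iff {m : InvPresentation R} {w : Word A} :
    (schutzenbergerAutomaton m).Path (schutzenbergerAutomaton m).initial w
      (schutzenbergerAutomaton m).initial ↔
    InvPresentation.mk R w ∈ (ClosedInverseSubmonoid.closure {m * m⁻¹}).carrier := by
  rw [schutzenberger_path_iff, mem_closure_idem_iff (mul_inv_idem m)]
  rfl

theorem schutzenberger_path_self (w : Word A) :
    (schutzenbergerAutomaton (InvPresentation.mk R w)).Path (schutzenbergerAutomaton _).initial w
      (schutzenbergerAutomaton _).terminal :=
  schutzenberger_path_iff.2 (mul_inv_mul' _)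

/-- Reduces the order, and with antisymmetry the word problem, to a membership question: `a ≤ b`
holds exactly when `b a⁻¹` lies above `a a⁻¹`. -/
theorem mk_natLE_iff {u v : Word A} :
    NatLE (InvPresentation.mk R u) (InvPresentation.mk R v) ↔
      InvPresentation.mk R (v ++ invRev u) ∈ (ClosedInverseSubmonoid.closure
        {InvPresentation.mk R u * (InvPresentation.mk R u)⁻¹}).carrier := by
  rw [mem_closure_idem_iff (mul_inv_idem _), InvPresentation.mk_append, ← InvPresentation.mk_inv]
  set a := InvPresentation.mk R u
  set b := InvPresentation.mk R v
  constructor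
  · rintro ⟨e, he, h⟩
    rw [h, mul_inv_rev', inv_idem he]
    have hb := mul_inv_idem b
    have hc := InverseMonoid.idem_comm he hb
    calc e * b * (b⁻¹ * e) * (b * (b⁻¹ * e))
        = e * (b * b⁻¹) * (e * (b * b⁻¹)) * e := by simp only [mul_assoc]
      _ = e * b * (b⁻¹ * e) := by rw [mul_idem_idem he hb]; simp only [mul_assoc]
  · intro h
    refine ⟨a * a⁻¹ , mul_inv_idem a, ?_⟩
    have h1 : a * a⁻¹ * (b * a⁻¹ * a) = a := by
      calc a * a⁻¹ * (b * a⁻¹ * a) = a * a⁻¹ * (b * a⁻¹) * a := by simp only [mul_assoc]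
        _ = a := by rw [h, mul_inv_mul']
    -- The trailing idempotent `a⁻¹ a` is moved to the left of `b` as an idempotent `f`; since `f a
    -- = a`, it is then absorbed by `a a⁻¹`.
    obtain ⟨f, hf, hfb⟩ := natLE_mul_idem b (inv_mul_idem a)
    rw [← mul_assoc] at hfb
    have h2 : f * a = a := by
      conv_lhs => rw [← h1, hfb, ← mul_assoc, ← mul_assoc, ← InverseMonoid.idem_comm
        (mul_inv_idem a) hf, mul_assoc (a * a⁻¹), hf, mul_assoc, ← hfb]
      exact h1
    calc a = a * a⁻¹ * f * b := by conv_lhs => rw [← h1, hfb, ← mul_assoc]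
      _ = f * a * a⁻¹ * b := by
        rw [InverseMonoid.idem_comm (mul_inv_idem a) hf]; simp only [mul_assoc]
      _ = a * a⁻¹ * b := by rw [h2]

theorem natLE_antisymm {M : Type*} [InverseMonoid M] {a b : M} (h : NatLE a b)
    (h' : NatLE b a) : a = b := by
  obtain ⟨e, he, rfl⟩ := h
  obtain ⟨f, hf, h⟩ := h'
  have : e * b = b := by
    conv_lhs => rw [h, ← mul_assoc, InverseMonoid.idem_comm he hf, mul_assoc, ← mul_assoc e, he]
    exact h.symm
  exact this

end Schutzenberger

/-! ### Edge foldings and expansions -/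

namespace LabeledGraph

variable {A : Type*}

theorem quot_mk_isHom (G : LabeledGraph A) (r : G.V → G.V → Prop) :
    G.IsHom (G.quot r) (Quot.mk r) := fun u _ v h => ⟨u, v, rfl, rfl, h⟩

theorem IsHom.quot_lift {G H : LabeledGraph A} {f : G.V → H.V} (hf : G.IsHom H f)
    {r : G.V → G.V → Prop} (hr : ∀ a b, r a b → f a = f b) :
    (G.quot r).IsHom H (Quot.lift f hr) := by
  rintro _ x _ ⟨u, v, rfl, rfl, h⟩
  exact hf _ _ _ h

theorem inl_isHom (G H : LabeledGraph A) : G.IsHom (G.sum H) Sum.inl :=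
  fun u _ v h => Or.inl ⟨u, v, rfl, rfl, h⟩

theorem inr_isHom (G H : LabeledGraph A) : H.IsHom (G.sum H) Sum.inr :=
  fun u _ v h => Or.inr ⟨u, v, rfl, rfl, h⟩

theorem IsHom.sum_elim {G H K : LabeledGraph A} {f : G.V → K.V} {g : H.V → K.V}
    (hf : G.IsHom K f) (hg : H.IsHom K g) : (G.sum H).IsHom K (Sum.elim f g) := by
  rintro _ x _ (⟨u, v, rfl, rfl, h⟩ | ⟨u, v, rfl, rfl, h⟩)
  · exact hf _ _ _ h
  · exact hg _ _ _ h

theorem sigma_mk_isHom {ι : Type*} (G : ι → LabeledGraph A) (i : ι) :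
    (G i).IsHom (sigma G) (fun u => (⟨i, u⟩ : Σ i, (G i).V)) := fun u _ v h => ⟨i, u, v, rfl, rfl, h⟩

theorem IsHom.sigma_elim {ι : Type*} {G : ι → LabeledGraph A} {K : LabeledGraph A}
    {f : ∀ i, (G i).V → K.V} (hf : ∀ i, (G i).IsHom K (f i)) :
    (sigma G).IsHom K fun p => f p.1 p.2 := by
  rintro _ x _ ⟨i, u, v, rfl, rfl, h⟩
  exact hf i _ _ _ h

theorem line_isHom_iff {G : LabeledGraph A} {w : Word A} {f : Fin (w.length + 1) → G.V} :
    (line w).IsHom G f ↔ ∀ i : Fin w.length, G.edge (f i.castSucc) (w.get i) (f i.succ) := by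
  constructor
  · exact fun h i => h _ _ _ ⟨i, Or.inl ⟨rfl, rfl, rfl⟩⟩
  · rintro h _ x _ ⟨i, ⟨rfl, rfl, rfl⟩ | ⟨rfl, rfl, rfl⟩⟩
    · exact h i
    · exact G.edge_inv _ _ _ (h i)

/-- Paths are morphisms from linear graphs, so adjoined paths and flowers, being quotients of sums
of linear graphs, acquire universal properties. -/
theorem path_iff_exists_line {G : LabeledGraph A} {b : G.V} : ∀ {w : Word A} {a : G.V},
    G.Path a w b ↔ ∃ f : Fin (w.length + 1) → G.V, (line w).IsHom G f ∧ f 0 = a ∧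
      f (Fin.last _) = b
  | [], a => by
    constructor
    · intro h
      exact ⟨fun _ => a, line_isHom_iff.2 fun i => i.elim0, rfl, h⟩
    · rintro ⟨f, -, rfl, rfl⟩
      rfl
  | x :: w, a => by
    constructor
    · rintro ⟨s, hs, h⟩
      obtain ⟨f, hf, h0, hl⟩ := path_iff_exists_line.1 h
      rw [line_isHom_iff] at hf
      refine ⟨Fin.cons a f, line_isHom_iff.2 fun i => ?_, rfl, hl⟩
      cases i using Fin.cases with
      | zero => subst h0; exact hs
      | succ i => exact hf i
    · rintro ⟨f, hf, rfl, rfl⟩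
      rw [line_isHom_iff] at hf
      refine ⟨f 1, hf 0, path_iff_exists_line.2 ⟨fun i => f i.succ, ?_, rfl, rfl⟩⟩
      exact line_isHom_iff.2 fun i => hf i.succ

theorem line_path (w : Word A) : (line w).Path (0 : Fin (w.length + 1)) w (Fin.last w.length) :=
  path_iff_exists_line.2 ⟨id, fun _ _ _ h => h, rfl, rfl⟩

theorem line_reachable (w : Word A) : (line w).ReachableFrom (0 : Fin (w.length + 1)) := by
  intro i
  change Fin (w.length + 1) at i
  induction i using Fin.induction with
  | zero => exact ⟨[], rfl⟩
  | succ i ih =>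
    obtain ⟨u, hu⟩ := ih
    exact ⟨u ++ [w.get i], hu.append (path_singleton.2 ⟨i, Or.inl ⟨rfl, rfl, rfl⟩⟩)⟩

theorem isFinite_of_finite [Finite A] (G : LabeledGraph A) (h : Finite G.V) : G.IsFinite :=
  ⟨h, Subtype.finite⟩

/-- Whenever a path is labeled by one side of a relation, a parallel path is labeled by the other
side. -/
def ExpansionClosed (R : Word A → Word A → Prop) (G : LabeledGraph A) : Prop :=
  ∀ a b u v, R u v ∨ R v u → G.Path a u b → G.Path a v b

theorem Deterministic.rewriteClosed {X P : Type*} {bl : P → Word X} {G : LabeledGraph (X ⊕ P)}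
    (hG : G.Deterministic) (hE : G.ExpansionClosed (CellRel bl)) : G.RewriteClosed bl := by
  -- The expansion `ρ → ρρ` puts a loop labeled `ρ` at `q`; two `ρ`-edges ending at `q` start at the
  -- same vertex, so `p = q`. The expansion `ρ → ρ bl(ρ)` then closes the path `bl ρ` at `q`.
  have key : ∀ p ρ q, G.edge p (Sum.inr ρ, true) q → p = q ∧ G.Path q (liftWord P (bl ρ)) q := by
    intro p ρ q h
    have hp : G.Path p (cellWord X ρ) q := path_singleton.2 h
    have h1 := hE _ _ _ _ (Or.inr (.idem ρ)) hp
    have h2 := hE _ _ _ _ (Or.inl (.boundary ρ)) hp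
    obtain ⟨s, hs, h1⟩ := path_append_iff.1 h1
    obtain ⟨t, ht, h2⟩ := path_append_iff.1 h2
    obtain rfl := hG.path_unique hp hs
    obtain rfl := hG.path_unique hp ht
    exact ⟨hG.path_unique hp.invRev h1.invRev, h2⟩
  intro u m m' v hr h
  cases hr with
  | cancel x =>
    obtain ⟨s, hs, t, ht, rfl⟩ := h
    exact hG _ _ _ _ (G.edge_inv _ _ _ hs) ht
  | erase ρ b =>
    cases b
    · exact ((key _ _ _ (G.edge_inv _ _ _ (path_singleton.1 h))).1).symm
    · exact (key _ _ _ (path_singleton.1 h)).1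
  | boundary ρ =>
    obtain ⟨rfl, h⟩ := key _ _ _ (path_singleton.1 h)
    exact h
  | boundary_inv ρ =>
    obtain ⟨rfl, h⟩ := key _ _ _ (G.edge_inv _ _ _ (path_singleton.1 h))
    exact h.invRev

end LabeledGraph

theorem coset_expansionClosed {A : Type*} {R : Word A → Word A → Prop}
    (H : ClosedInverseSubmonoid (InvPresentation R)) :
    (cosetAutomaton H).ExpansionClosed R := by
  intro a b u v h
  refine coset_path_of_natLE ?_
  have : InvPresentation.mk R u = InvPresentation.mk R v := by
    rcases h with h | h
    · exact InvPresentation.mk_eq_of_rel (.rel _ _ h)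
    · exact (InvPresentation.mk_eq_of_rel (.rel _ _ h)).symm
  rw [this]; exact NatLE.refl _

/-! ### Foldings, expansions and flower automata: universal properties and invariants -/

namespace Automaton

open LabeledGraph

variable {A : Type*}

theorem Complete.deterministic {R : Word A → Word A → Prop} {B : Automaton A}
    (hB : B.Complete R) : B.Deterministic := by
  intro u x v v' h h'
  by_contra hne
  exact hB _ (Or.inl (.mk B u x v v' h h' hne))

theorem Complete.expansionClosed {R : Word A → Word A → Prop} {B : Automaton A}
    (hB : B.Complete R) : B.ExpansionClosed R := by
  intro a b u v h hu
  by_contra hv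
  exact hB _ (Or.inr (.mk B a b u v h hu hv))

theorem fold_isHom (B : Automaton A) (q r : B.V) :
    B.IsHom (B.fold q r).toLabeledGraph (Quot.mk _) := quot_mk_isHom _ _

/-- The inclusion of `B` into the automaton with an adjoined path. -/
def adjoinPathIncl (B : Automaton A) (a : B.V) (v : Word A) (b : B.V) :
    B.V → (B.adjoinPath a v b).V := fun u => Quot.mk _ (Sum.inl u)

/-- The adjoined path. -/
def adjoinPathLine (B : Automaton A) (a : B.V) (v : Word A) (b : B.V) :
    Fin (v.length + 1) → (B.adjoinPath a v b).V := fun u => Quot.mk _ (Sum.inr u)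

section AdjoinPath

variable {B : Automaton A} {a : B.V} {v : Word A} {b : B.V}

theorem adjoinPathIncl_isHom : B.IsHom (B.adjoinPath a v b).toLabeledGraph
    (B.adjoinPathIncl a v b) := (quot_mk_isHom _ _).comp (inl_isHom _ _)

theorem adjoinPathLine_isHom : (line v).IsHom (B.adjoinPath a v b).toLabeledGraph
    (B.adjoinPathLine a v b) := (quot_mk_isHom _ _).comp (inr_isHom _ _)

theorem adjoinPathLine_zero : B.adjoinPathLine a v b 0 = B.adjoinPathIncl a v b a := by
  refine Eq.symm (Quot.sound ?_)
  exact Or.inl ⟨rfl, rfl⟩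

theorem adjoinPathLine_last :
    B.adjoinPathLine a v b (Fin.last v.length) = B.adjoinPathIncl a v b b := by
  refine Eq.symm (Quot.sound ?_)
  exact Or.inr ⟨rfl, rfl⟩

theorem adjoinPath_cases (p : (B.adjoinPath a v b).V) :
    (∃ u, p = B.adjoinPathIncl a v b u) ∨ ∃ i, p = B.adjoinPathLine a v b i := by
  obtain ⟨u | i, rfl⟩ := Quot.exists_rep p
  · exact Or.inl ⟨u, rfl⟩
  · exact Or.inr ⟨i, rfl⟩

theorem adjoinPath_edge_cases {p q : (B.adjoinPath a v b).V} {x : A × Bool}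
    (h : (B.adjoinPath a v b).edge p x q) :
    (∃ u u', p = B.adjoinPathIncl a v b u ∧ q = B.adjoinPathIncl a v b u' ∧ B.edge u x u') ∨
    ∃ i i', p = B.adjoinPathLine a v b i ∧ q = B.adjoinPathLine a v b i' ∧ (line v).edge i x i' := by
  obtain ⟨_, _, rfl, rfl, ⟨u, u', rfl, rfl, h⟩ | ⟨u, u', rfl, rfl, h⟩⟩ := h
  · exact Or.inl ⟨u, u', rfl, rfl, h⟩
  · exact Or.inr ⟨u, u', rfl, rfl, h⟩

theorem adjoinPath_finite [Finite B.V] : Finite (B.adjoinPath a v b).V :=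
  Finite.of_surjective
    (fun u : B.V ⊕ Fin (v.length + 1) => (Quot.mk _ u : (B.adjoinPath a v b).V)) Quot.exists_rep

theorem adjoinPath_exists_hom {G : LabeledGraph A} {f : B.V → G.V} (hf : B.IsHom G f)
    (h : G.Path (f a) v (f b)) : ∃ g, (B.adjoinPath a v b).IsHom G g ∧
      ∀ u, g (B.adjoinPathIncl a v b u) = f u := by
  obtain ⟨l, hl, h0, h1⟩ := path_iff_exists_line.1 h
  refine ⟨_, (hf.sum_elim hl).quot_lift ?_, fun _ => rfl⟩
  rintro _ _ (⟨rfl, rfl⟩ | ⟨rfl, rfl⟩)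
  · exact h0.symm
  · exact h1.symm

end AdjoinPath

theorem flower_hom {Y : Set (Word A)} {G : LabeledGraph A} {p : G.V}
    (h : ∀ y ∈ Y, G.Path p y p) :
    ∃ g, (flower Y).IsHom G g ∧ g (flower Y).initial = p := by
  choose l hl h0 h1 using fun y : Y => path_iff_exists_line.1 (h y.1 y.2)
  refine ⟨_, IsHom.quot_lift (IsHom.sum_elim (f := fun _ => p)
    (line_isHom_iff (w := []).2 fun i => i.elim0) (IsHom.sigma_elim hl)) ?_, rfl⟩
  rintro _ _ ⟨rfl, y, rfl | rfl⟩
  · exact (h0 y).symm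
  · exact (h1 y).symm

/-- The petal labeled `y`. -/
def flowerPetal {Y : Set (Word A)} (y : Y) : Fin (y.1.length + 1) → (flower Y).V :=
  fun i => Quot.mk _ (Sum.inr ⟨y, i⟩)

section Flower

variable {Y : Set (Word A)}

theorem flowerPetal_isHom (y : Y) : (line y.1).IsHom (flower Y).toLabeledGraph (flowerPetal y) :=
  (quot_mk_isHom _ _).comp ((inr_isHom _ _).comp
    (sigma_mk_isHom (fun y : Y => line y.1) y))

theorem flowerPetal_zero (y : Y) : flowerPetal y 0 = (flower Y).initial :=
  (Quot.sound ⟨rfl, y, Or.inl rfl⟩).symm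

theorem flowerPetal_last (y : Y) : flowerPetal y (Fin.last _) = (flower Y).initial :=
  (Quot.sound ⟨rfl, y, Or.inr rfl⟩).symm

theorem flower_loop {y : Word A} (hy : y ∈ Y) :
    (flower Y).Path (flower Y).initial y (flower Y).initial := by
  have := (flowerPetal_isHom ⟨y, hy⟩).path (line_path y)
  rwa [flowerPetal_zero, flowerPetal_last] at this

theorem flower_reachable : (flower Y).ReachableFrom (flower Y).initial := by
  intro q
  obtain ⟨u | ⟨y, i⟩, rfl⟩ := Quot.exists_rep q
  · obtain rfl : u = (0 : Fin 1) := Subsingleton.elim (α := Fin 1) _ _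
    exact ⟨[], rfl⟩
  · obtain ⟨w, hw⟩ := line_reachable y.1 i
    have := (flowerPetal_isHom y).path hw
    rw [flowerPetal_zero] at this
    exact ⟨w, this⟩

theorem flower_finite (hY : Y.Finite) : Finite (flower Y).V := by
  have := hY.to_subtype
  have : Finite (Fin 1 ⊕ Σ y : Y, Fin (y.1.length + 1)) := inferInstance
  exact Finite.of_surjective
    (fun u : Fin 1 ⊕ Σ y : Y, Fin (y.1.length + 1) => (Quot.mk _ u : (flower Y).V))
    Quot.exists_rep

end Flower

/-- What foldings and expansions, starting from the flower automaton of `Y`, preserve. -/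
structure FlowerLike (Y : Set (Word A)) {G : LabeledGraph A} (p : G.V) (B : Automaton A) :
    Prop where
  finite : Finite B.V
  reachable : B.ReachableFrom B.initial
  terminal_eq : B.terminal = B.initial
  loop : ∀ y ∈ Y, B.Path B.initial y B.initial
  exists_hom : ∃ f, B.IsHom G f ∧ f B.initial = p

theorem Step.finite {R : Word A → Word A → Prop} {B C : Automaton A} (h : Step R B C)
    (hB : Finite B.V) : Finite C.V := by
  obtain ⟨q, r⟩ | ⟨a, b, u, v⟩ := h
  · exact Quot.finite _
  · exact adjoinPath_finite

/-- The morphism to `G` survives because `G` is complete in spirit: determinism already identifies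
the images of folded vertices, and `ExpansionClosed` supplies an image for the adjoined path. -/
theorem FlowerLike.step {R : Word A → Word A → Prop} {Y : Set (Word A)} {G : LabeledGraph A}
    (hG : G.Deterministic) (hE : G.ExpansionClosed R) {p : G.V} {B C : Automaton A}
    (hB : FlowerLike Y p B) (h : Step R B C) : FlowerLike Y p C := by
  obtain ⟨hfin, hr, ht, hl, f, hf, hp⟩ := hB
  have hfin' := h.finite hfin
  rcases h with h | h
  · obtain ⟨s, x, q, r, hq, hr', -⟩ := h
    refine ⟨hfin', fun t => ?_, congrArg (Quot.mk _) ht, fun y hy =>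
      (B.fold_isHom q r).path (hl y hy), _, hf.quot_lift ?_, hp⟩
    · obtain ⟨t, rfl⟩ := Quot.exists_rep t
      obtain ⟨w, hw⟩ := hr t
      exact ⟨w, (B.fold_isHom q r).path hw⟩
    · rintro _ _ ⟨rfl, rfl⟩
      exact hG _ _ _ _ (hf _ _ _ hq) (hf _ _ _ hr')
  · obtain ⟨a, b, u, v, hR, hu, -⟩ := h
    obtain ⟨g, hg, hgf⟩ := adjoinPath_exists_hom hf (hE _ _ _ _ hR (hf.path hu))
    refine ⟨hfin', fun t => ?_, congrArg (B.adjoinPathIncl a v b) ht, fun y hy =>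
      adjoinPathIncl_isHom.path (hl y hy), g, hg, (hgf _).trans hp⟩
    rcases adjoinPath_cases t with ⟨t, rfl⟩ | ⟨i, rfl⟩
    · obtain ⟨w, hw⟩ := hr t
      exact ⟨w, adjoinPathIncl_isHom.path hw⟩
    · obtain ⟨w, hw⟩ := hr a
      obtain ⟨w', hw'⟩ := line_reachable v i
      have h1 := adjoinPathLine_isHom (B := B) (a := a) (b := b) |>.path hw'
      rw [adjoinPathLine_zero] at h1
      exact ⟨w ++ w', (adjoinPathIncl_isHom.path hw).append h1⟩

theorem FlowerLike.reaches {R : Word A → Word A → Prop} {Y : Set (Word A)} {G : LabeledGraph A}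
    (hG : G.Deterministic) (hE : G.ExpansionClosed R) {p : G.V} {B C : Automaton A}
    (hB : FlowerLike Y p B) (h : Reaches R B C) : FlowerLike Y p C := by
  induction h with
  | refl => exact hB
  | tail _ h ih => exact ih.step hG hE h

theorem flowerLike_flower {Y : Set (Word A)} (hY : Y.Finite) {G : LabeledGraph A} {p : G.V}
    (h : ∀ y ∈ Y, G.Path p y p) : FlowerLike Y p (flower Y) :=
  ⟨flower_finite hY, flower_reachable, rfl, fun _ hy => flower_loop hy, flower_hom h⟩

end Automaton

/-! ### Complete automata and `ω`-coset automata -/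

section

variable {X P : Type*} {bl : P → Word X}

theorem derivable_iff_coset_loop {Y : Set (Word (X ⊕ P))} {w : Word (X ⊕ P)} :
    Derivable bl Y w ↔ (cosetAutomaton (ClosedInverseSubmonoid.closure (MXP.mk bl '' Y))).Path
      (ClosedInverseSubmonoid.baseCoset _) w (ClosedInverseSubmonoid.baseCoset _) :=
  mk_mem_closure_iff.symm.trans coset_loop_iff.symm

/-- Complete automata obtained from the flower automaton are `ω`-coset automata. -/
theorem complete_iso_coset [Finite X] [Finite P] {Y : Set (Word (X ⊕ P))} (hY : Y.Finite)
    {B : Automaton (X ⊕ P)} (h : Automaton.Reaches (CellRel bl) (Automaton.flower Y) B)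
    (hB : B.Complete (CellRel bl)) : B.IsFinite ∧
      B.Iso (cosetAutomaton (ClosedInverseSubmonoid.closure (MXP.mk bl '' Y))) := by
  set H := ClosedInverseSubmonoid.closure (MXP.mk bl '' Y)
  have hfl : Automaton.FlowerLike Y (G := (cosetAutomaton H).toLabeledGraph) H.baseCoset B := by
    refine Automaton.FlowerLike.reaches (cosetAutomaton_deterministic H)
      (coset_expansionClosed H) (Automaton.flowerLike_flower hY fun y hy => ?_) h
    exact derivable_iff_coset_loop.1 (by simpa using Derivable.nil.mul hy)
  obtain ⟨hfin, hr, ht, hl, f, hf, hp⟩ := hfl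
  refine ⟨B.isFinite_of_finite hfin, ?_⟩
  have hdet := hB.deterministic
  -- Closed paths of `B` are carried into the coset automaton by `f`; conversely, `B` contains the
  -- loops in `Y` and, being complete, admits every rewriting rule.
  obtain ⟨g, hg, -, hge⟩ := LabeledGraph.exists_equiv_of_loops hdet
    (cosetAutomaton_deterministic H) (p' := H.baseCoset) hr coset_reachable fun w => by
      constructor
      · intro hw
        have := hf.path hw
        rwa [hp] at this
      · intro hw
        exact (derivable_iff_coset_loop.2 hw).path (hdet.rewriteClosed hB.expansionClosed) hl
  exact ⟨g, hge, hg, by rw [ht]; exact hg⟩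

end

/-! ### Termination of the folding procedure -/

namespace LabeledGraph

variable {A : Type*}

/-- The equivalence relation along which all foldings identify vertices. -/
inductive FoldEq (G : LabeledGraph A) : G.V → G.V → Prop
  | refl (p : G.V) : FoldEq G p p
  | symm {p q : G.V} : FoldEq G p q → FoldEq G q p
  | trans {p q r : G.V} : FoldEq G p q → FoldEq G q r → FoldEq G p r
  | fold {p p' q q' : G.V} {x : A × Bool} : FoldEq G p p' → G.edge p x q → G.edge p' x q' →
      FoldEq G q q'

/-- The deterministic graph obtained by all foldings. -/
def determinize (G : LabeledGraph A) : LabeledGraph A := G.quot G.FoldEq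

/-- The projection to the determinization. -/
def toDet (G : LabeledGraph A) : G.V → G.determinize.V := Quot.mk _

theorem toDet_isHom (G : LabeledGraph A) : G.IsHom G.determinize G.toDet := quot_mk_isHom _ _

theorem toDet_eq_iff {G : LabeledGraph A} {p q : G.V} : G.toDet p = G.toDet q ↔ G.FoldEq p q :=
  ⟨fun h => (Equivalence.eqvGen_iff ⟨.refl, .symm, .trans⟩).1 (Quot.eqvGen_exact h),
    fun h => Quot.sound h⟩

theorem determinize_deterministic (G : LabeledGraph A) : G.determinize.Deterministic := by
  rintro _ x _ _ ⟨u, v, rfl, rfl, h⟩ ⟨u', v', hu, rfl, h'⟩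
  exact toDet_eq_iff.2 (.fold (toDet_eq_iff.1 hu.symm) h h')

/-- The universal property of `determinize`: every morphism to a deterministic graph factors through
it. -/
theorem IsHom.eq_of_foldEq {G H : LabeledGraph A} {f : G.V → H.V} (hf : G.IsHom H f)
    (hH : H.Deterministic) {p q : G.V} (h : G.FoldEq p q) : f p = f q := by
  induction h with
  | refl => rfl
  | symm _ ih => exact ih.symm
  | trans _ _ ih ih' => exact ih.trans ih'
  | fold _ h h' ih => exact hH _ _ _ _ (hf _ _ _ h) (ih ▸ hf _ _ _ h')

theorem IsHom.exists_det_map {G H : LabeledGraph A} {f : G.V → H.V} (hf : G.IsHom H f)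
    (hH : H.Deterministic) : ∃ g, G.determinize.IsHom H g ∧ ∀ p, g (G.toDet p) = f p :=
  ⟨_, hf.quot_lift fun _ _ h => hf.eq_of_foldEq hH h, fun _ => rfl⟩

theorem IsHom.line_cons {G : LabeledGraph A} {x : A × Bool} {w : Word A}
    {f : Fin (w.length + 1 + 1) → G.V} (hf : (line (x :: w)).IsHom G f) :
    G.edge (f 0) x (f 1) ∧ G.Path (f 1) w (f (Fin.last _)) := by
  rw [line_isHom_iff] at hf
  exact ⟨hf 0, path_iff_exists_line.2 ⟨fun i => f i.succ,
    line_isHom_iff.2 fun i => hf i.succ, rfl, rfl⟩⟩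

variable {X P : Type*}

/-- The edges labeled `ρ ∈ P` that are not closed, and the edges labeled `ρ ∈ P` at whose terminal
vertex there is no closed path labeled `bl ρ`. -/
def defects (bl : P → Word X) (G : LabeledGraph (X ⊕ P)) : Set (G.V × P × G.V × Bool) :=
  {t | G.edge t.1 (Sum.inr t.2.1, true) t.2.2.1 ∧ (t.2.2.2 = true → t.1 ≠ t.2.2.1) ∧
    (t.2.2.2 = false → ¬ G.Path t.2.2.1 (liftWord P (bl t.2.1)) t.2.2.1)}

variable {bl : P → Word X}

/-- A morphism preserves equality of vertices and closed paths, so it can repair defects but not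
cause them; new defects could only sit on `ρ`-edges outside the image, which `hs` excludes. -/
theorem defects_subset {G H : LabeledGraph (X ⊕ P)} {f : G.V → H.V} (hf : G.IsHom H f)
    (hs : ∀ p ρ q, H.edge p (Sum.inr ρ, true) q →
      ∃ p' q', G.edge p' (Sum.inr ρ, true) q' ∧ f p' = p ∧ f q' = q) :
    H.defects bl ⊆ (fun t => (f t.1, t.2.1, f t.2.2.1, t.2.2.2)) '' G.defects bl := by
  rintro ⟨p, ρ, q, i⟩ ⟨h, h1, h2⟩
  obtain ⟨p', q', h', rfl, rfl⟩ := hs _ _ _ h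
  exact ⟨(p', ρ, q', i), ⟨h', fun hi e => h1 hi (congrArg f e), fun hi e => h2 hi (hf.path e)⟩, rfl⟩

/-- The number of defects of the determinization. -/
noncomputable def weight (bl : P → Word X) (G : LabeledGraph (X ⊕ P)) : ℕ := (G.determinize.defects bl).ncard

theorem defects_finite [Finite P] {G : LabeledGraph (X ⊕ P)} (hG : Finite G.V) :
    (G.determinize.defects bl).Finite := by
  have : Finite G.determinize.V := Quot.finite _
  exact Set.toFinite _

section Weight

variable {G H : LabeledGraph (X ⊕ P)} {f : G.V → H.V}

/-- Only the `ρ`-edges have to be covered, and only after folding: an adjoined path may contribute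
new vertices and new edges labeled over `X` without affecting the weight. -/
theorem exists_det_hom_surjective (hf : G.IsHom H f)
    (hs : ∀ p ρ q, H.edge p (Sum.inr ρ, true) q → ∃ p' q', G.edge p' (Sum.inr ρ, true) q' ∧
      H.toDet (f p') = H.toDet p ∧ H.toDet (f q') = H.toDet q) :
    ∃ g, G.determinize.IsHom H.determinize g ∧ (∀ p, g (G.toDet p) = H.toDet (f p)) ∧
      ∀ p ρ q, H.determinize.edge p (Sum.inr ρ, true) q →
        ∃ p' q', G.determinize.edge p' (Sum.inr ρ, true) q' ∧ g p' = p ∧ g q' = q := by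
  obtain ⟨g, hg, hgf⟩ := (H.toDet_isHom.comp hf).exists_det_map H.determinize_deterministic
  refine ⟨g, hg, hgf, ?_⟩
  rintro _ ρ _ ⟨p, q, rfl, rfl, h⟩
  obtain ⟨p', q', h', hp, hq⟩ := hs _ _ _ h
  exact ⟨_, _, G.toDet_isHom _ _ _ h', (hgf _).trans hp, (hgf _).trans hq⟩

theorem weight_le_of_hom [Finite P] (hG : Finite G.V) (hf : G.IsHom H f)
    (hs : ∀ p ρ q, H.edge p (Sum.inr ρ, true) q → ∃ p' q', G.edge p' (Sum.inr ρ, true) q' ∧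
      H.toDet (f p') = H.toDet p ∧ H.toDet (f q') = H.toDet q) : H.weight bl ≤ G.weight bl := by
  obtain ⟨g, hg, -, hs'⟩ := exists_det_hom_surjective hf hs
  have hfin := defects_finite (bl := bl) hG
  exact (Set.ncard_le_ncard (defects_subset hg hs') (hfin.image _)).trans (Set.ncard_image_le hfin)

theorem weight_lt_of_hom [Finite P] (hG : Finite G.V) (hdet : G.Deterministic) (hf : G.IsHom H f)
    (hs : ∀ p ρ q, H.edge p (Sum.inr ρ, true) q → ∃ p' q', G.edge p' (Sum.inr ρ, true) q' ∧
      H.toDet (f p') = H.toDet p ∧ H.toDet (f q') = H.toDet q) {a b : G.V} {ρ : P}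
    (hab : G.edge a (Sum.inr ρ, true) b)
    (h : (a ≠ b ∧ H.toDet (f a) = H.toDet (f b)) ∨ (¬ G.Path b (liftWord P (bl ρ)) b ∧
      H.determinize.Path (H.toDet (f b)) (liftWord P (bl ρ)) (H.toDet (f b)))) :
    H.weight bl < G.weight bl := by
  obtain ⟨g, hg, hgf, hs'⟩ := exists_det_hom_surjective hf hs
  have hid : G.IsHom G id := fun _ _ _ h => h
  -- Since `G` is already deterministic, `k` inverts the projection to its determinization on the
  -- left; so the defect at `a`, `b` is still one there.
  obtain ⟨k, hk, hk'⟩ := hid.exists_det_map hdet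
  have hfin := defects_finite (bl := bl) hG
  have key : ∃ t ∈ G.determinize.defects bl,
      (g t.1, t.2.1, g t.2.2.1, t.2.2.2) ∉ H.determinize.defects bl := by
    rcases h with ⟨h1, h2⟩ | ⟨h1, h2⟩
    · refine ⟨(G.toDet a, ρ, G.toDet b, true), ⟨G.toDet_isHom _ _ _ hab, fun _ e => h1 ?_, nofun⟩,
        fun h => h.2.1 rfl (by simpa only [hgf] using h2)⟩
      simpa only [hk', id] using congrArg k e
    · refine ⟨(G.toDet a, ρ, G.toDet b, false), ⟨G.toDet_isHom _ _ _ hab, nofun, fun _ e => h1 ?_⟩,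
        fun h => h.2.2 rfl (by simpa only [hgf] using h2)⟩
      simpa only [hk', id] using hk.path e
  obtain ⟨t, ht, ht'⟩ := key
  -- The image of the defect `t` is not a defect, so `t` can be omitted and the remaining defects
  -- still cover those of `H`.
  have hsub : H.determinize.defects bl ⊆
      (fun t => (g t.1, t.2.1, g t.2.2.1, t.2.2.2)) '' (G.determinize.defects bl \ {t}) := by
    intro y hy
    obtain ⟨s, hs1, rfl⟩ := defects_subset hg hs' hy
    refine ⟨s, ⟨hs1, ?_⟩, rfl⟩
    rintro rfl
    exact ht' hy
  calc (H.determinize.defects bl).ncard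
      ≤ (G.determinize.defects bl \ {t}).ncard :=
        (Set.ncard_le_ncard hsub (hfin.sdiff.image _)).trans (Set.ncard_image_le hfin.sdiff)
    _ < _ := Set.ncard_sdiff_singleton_lt_of_mem ht hfin

end Weight

end LabeledGraph

/-! ### Effect of foldings and expansions on the weight -/

namespace Automaton

open LabeledGraph

variable {X P : Type*} {bl : P → Word X}

theorem fold_weight_le [Finite P] {B C : Automaton (X ⊕ P)} (hB : Finite B.V) (h : Folding B C) :
    C.weight bl ≤ B.weight bl := by
  obtain ⟨s, x, q, r, -, -, -⟩ := h
  refine weight_le_of_hom hB (B.fold_isHom q r) ?_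
  rintro _ ρ _ ⟨p, q', rfl, rfl, h⟩
  exact ⟨p, q', h, rfl, rfl⟩

theorem fold_card_lt {A : Type*} {B C : Automaton A} (hB : Finite B.V) (h : Folding B C) :
    Nat.card C.V < Nat.card B.V := by
  obtain ⟨s, x, q, r, -, -, hne⟩ := h
  have hsurj : Function.Surjective (Quot.mk _ : B.V → (B.fold q r).V) := Quot.exists_rep
  refine lt_of_le_of_ne (Nat.card_le_card_of_surjective _ hsurj) fun hc => hne ?_
  have : Finite (B.fold q r).V := Quot.finite _
  have hinj := ((Nat.bijective_iff_surjective_and_card _).2 ⟨hsurj, hc.symm⟩).1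
  exact hinj (Quot.sound ⟨rfl, rfl⟩)

/-- The four kinds of expansion have this common form: the adjoined word begins with `ρ` at a vertex
`a` that already has a `ρ`-edge to `c`. After folding, the new first edge lies on the old one and
`t` is read from `c` to `b`. By `ht`, a further cell letter occurs only if `t = ρ` and `b = c`, and
that edge folds onto the old one too. Hypothesis `h` names the repaired defect. -/
theorem adjoinPath_cell_weight_lt.{u, v, w} {X : Type u} {P : Type v} {bl : P → Word X} [Finite P]
    {B : Automaton.{max u v, w} (X ⊕ P)} (hB : Finite B.V)
    (hdet : B.Deterministic) {a b c : B.V} {ρ : P} {t : Word (X ⊕ P)}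
    (hac : B.edge a (Sum.inr ρ, true) c)
    (ht : ∀ x ∈ t, ∀ ρ', x.1 = Sum.inr ρ' → t = cellWord X ρ ∧ b = c)
    (h : ∀ {G : LabeledGraph.{max u v, w} (X ⊕ P)} {f : B.V → G.V}, B.IsHom G f → G.Deterministic →
      G.Path (f c) t (f b) → (a ≠ c ∧ f a = f c) ∨ (¬ B.Path c (liftWord P (bl ρ)) c ∧
        G.Path (f c) (liftWord P (bl ρ)) (f c))) :
    (B.adjoinPath a (cellWord X ρ ++ t) b).weight bl < B.weight bl := by
  set C := B.adjoinPath a (cellWord X ρ ++ t) b with hC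
  have hι : B.IsHom C.toLabeledGraph (B.adjoinPathIncl a _ b) := adjoinPathIncl_isHom
  have hκ := C.toDet_isHom.comp hι
  have hD := C.determinize_deterministic
  have hl := C.toDet_isHom.comp
    (adjoinPathLine_isHom (B := B) (a := a) (b := b) (v := cellWord X ρ ++ t))
  obtain ⟨h1, h2⟩ := hl.line_cons
  have e0 := congrArg C.toDet (adjoinPathLine_zero (B := B) (a := a) (b := b) (v := cellWord X ρ ++ t))
  have e1 := congrArg C.toDet (adjoinPathLine_last (B := B) (a := a) (b := b) (v := cellWord X ρ ++ t))
  -- The second vertex of the adjoined path folds onto `c`, because both are reached from `a` by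
  -- `ρ`.
  have e2 : C.toDet (B.adjoinPathLine a (cellWord X ρ ++ t) b 1) =
      C.toDet (B.adjoinPathIncl a (cellWord X ρ ++ t) b c) := by
    refine hD _ _ _ _ h1 ?_
    have := hκ _ _ _ hac
    rwa [Function.comp_apply, ← e0] at this
  have h3 : C.determinize.Path (C.toDet (B.adjoinPathIncl a (cellWord X ρ ++ t) b c)) t
      (C.toDet (B.adjoinPathIncl a (cellWord X ρ ++ t) b b)) := by
    rw [← e1, ← e2]; exact h2
  refine weight_lt_of_hom hB hdet hι ?_ hac (h hκ hD h3)
  intro p ρ' q hpq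
  rcases adjoinPath_edge_cases hpq with ⟨u, u', rfl, rfl, he⟩ | ⟨_, _, rfl, rfl, j, hj⟩
  · exact ⟨u, u', he, rfl, rfl⟩
  · change Fin (t.length + 1) at j
    cases j using Fin.cases with
    | zero =>
      rcases hj with ⟨rfl, rfl, hx⟩ | ⟨-, -, hx⟩
      · obtain rfl : ρ' = ρ := by
          have : (Sum.inr ρ', true) = ((Sum.inr ρ, true) : (X ⊕ P) × Bool) := hx
          simpa using this
        exact ⟨a, c, hac, e0.symm, e2.symm⟩
      · have : (Sum.inr ρ', true) = ((Sum.inr ρ, false) : (X ⊕ P) × Bool) := hx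
        simp at this
    | succ j =>
      have hcell : ∀ y ∈ t, y.1 = Sum.inr ρ' → y = (Sum.inr ρ, true) := by
        intro y hy e
        rw [(ht y hy ρ' e).1] at hy
        exact List.mem_singleton.1 hy
      have hmem : t.get j ∈ t := t.get_mem j
      rcases hj with ⟨rfl, rfl, hx⟩ | ⟨-, -, hx⟩
      · have hx' : (Sum.inr ρ', true) = t.get j := hx
        obtain ⟨rfl, rfl⟩ := ht _ hmem ρ' (by rw [← hx'])
        obtain rfl : j = (0 : Fin 1) := Subsingleton.elim (α := Fin 1) _ _
        obtain rfl : ρ' = ρ := by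
          have : (Sum.inr ρ', true) = ((Sum.inr ρ, true) : (X ⊕ P) × Bool) := hx'
          simpa using this
        have h4 := path_singleton.1 h3
        -- Determinism is applied to the inverse edges: the second adjoined `ρ`-edge and the old one
        -- have the same terminal vertex, hence the same initial vertex.
        have h5 := hD _ _ _ _ (C.determinize.edge_inv _ _ _ h4)
          (C.determinize.edge_inv _ _ _ (hκ _ _ _ hac))
        exact ⟨a, b, hac, h5.symm.trans e2.symm, e1.symm⟩
      · have hx' : (Sum.inr ρ', true) = invLetter (t.get j) := hx
        have := hcell _ hmem (congrArg Prod.fst hx').symm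
        rw [this] at hx'
        simp [invLetter] at hx'

/-- Either direction of `ρ² = ρ` makes a `ρ`-edge closed that was not closed before. Either
direction of `ρ = ρ bl(ρ)` closes the path `bl ρ` at the end of a `ρ`-edge: it is adjoined there, or
its two ends `c` and `b` get identified because both are reached by `ρ` from `a`. -/
theorem expansion_weight_lt [Finite P] {B C : Automaton (X ⊕ P)} (hB : Finite B.V)
    (hdet : B.Deterministic) (h : Expansion (CellRel bl) B C) : C.weight bl < B.weight bl := by
  have hlift : ∀ (t : Word X), ∀ x ∈ liftWord P t, ∀ ρ', x.1 ≠ Sum.inr ρ' := by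
    intro t x hx ρ'
    obtain ⟨y, -, rfl⟩ := List.mem_map.1 hx
    simp
  obtain ⟨a, b, u, v, hR, hu, hv⟩ := h
  rcases hR with hR | hR
  · cases hR with
    | idem ρ =>
      obtain ⟨c, hac, hcb⟩ := path_append_iff.1 hu
      have hac' := path_singleton.1 hac
      have hcb' := path_singleton.1 hcb
      refine adjoinPath_cell_weight_lt (t := []) hB hdet hac' (by simp) fun {G f} hf hG hp => ?_
      obtain hp : f c = f b := hp
      refine Or.inl ⟨?_, ?_⟩
      · rintro rfl
        exact hv hcb
      · have h1 := hf _ _ _ hcb'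
        rw [← hp] at h1
        exact hG _ _ _ _ (G.edge_inv _ _ _ (hf _ _ _ hac')) (G.edge_inv _ _ _ h1)
    | boundary ρ =>
      have hab := path_singleton.1 hu
      refine adjoinPath_cell_weight_lt hB hdet hab
        (fun x hx ρ' e => absurd e (hlift _ x hx ρ')) fun {G f} hf hG hp => ?_
      exact Or.inr ⟨fun h => hv (hu.append h), hp⟩
  · cases hR with
    | idem ρ =>
      have hab := path_singleton.1 hu
      refine adjoinPath_cell_weight_lt hB hdet hab (fun _ _ _ _ => ⟨rfl, rfl⟩)
        fun {G f} hf hG hp => ?_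
      · refine Or.inl ⟨?_, ?_⟩
        · rintro rfl
          exact hv (hu.append hu)
        · exact hG _ _ _ _ (G.edge_inv _ _ _ (hf _ _ _ hab))
            (G.edge_inv _ _ _ (path_singleton.1 hp))
    | boundary ρ =>
      obtain ⟨c, hac, hcb⟩ := path_append_iff.1 hu
      refine adjoinPath_cell_weight_lt (t := []) hB hdet (path_singleton.1 hac) (by simp)
        fun {G f} hf hG hp => ?_
      obtain hp : f c = f b := hp
      have h1 := hf.path hcb
      rw [← hp] at h1
      refine Or.inr ⟨fun h => hv ?_, h1⟩
      rwa [← hdet.path_unique h hcb]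

/-- The procedure terminates when foldings take precedence. -/
theorem foldFirstStep_lex [Finite P] {B C : Automaton (X ⊕ P)} (hB : Finite B.V)
    (h : FoldFirstStep (CellRel bl) B C) :
    Prod.Lex (· < ·) (· < ·) (C.weight bl, Nat.card C.V) (B.weight bl, Nat.card B.V) := by
  rcases h with h | ⟨hdet, h⟩
  · rcases (fold_weight_le (bl := bl) hB h).lt_or_eq with hw | hw
    · exact .left _ _ hw
    · rw [hw]; exact .right _ (fold_card_lt hB h)
  · exact .left _ _ (expansion_weight_lt hB hdet h)

theorem FoldFirstStep.step {A : Type*} {R : Word A → Word A → Prop} {B C : Automaton A}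
    (h : FoldFirstStep R B C) : Step R B C := h.imp id And.right

theorem lex_wellFounded :
    WellFounded (Prod.Lex (· < ·) (· < ·) : ℕ × ℕ → ℕ × ℕ → Prop) :=
  WellFounded.prod_lex wellFounded_lt wellFounded_lt

theorem not_exists_infinite_run [Finite P] {B : Automaton (X ⊕ P)} (hB : Finite B.V) :
    ¬ ∃ run : ℕ → Automaton (X ⊕ P), run 0 = B ∧
      ∀ n, FoldFirstStep (CellRel bl) (run n) (run (n + 1)) := by
  rintro ⟨run, rfl, h⟩
  have hfin : ∀ n, Finite (run n).V := fun n => by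
    induction n with
    | zero => exact hB
    | succ n ih => exact (h n).step.finite ih
  exact (wellFounded_iff_isEmpty_descending_chain.1 lex_wellFounded).false
    ⟨fun n => ((run n).weight bl, Nat.card (run n).V), fun n => foldFirstStep_lex (hfin n) (h n)⟩

theorem exists_complete [Finite P] {B : Automaton (X ⊕ P)} (hB : Finite B.V) :
    ∃ C, Reaches (CellRel bl) B C ∧ C.Complete (CellRel bl) := by
  induction hw : (B.weight bl, Nat.card B.V) using lex_wellFounded.induction generalizing B with
  | _ w ih =>
    by_cases h : ∃ C, FoldFirstStep (CellRel bl) B C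
    · obtain ⟨C, hC⟩ := h
      obtain ⟨D, hD, hD'⟩ := ih _ (hw ▸ foldFirstStep_lex hB hC) (hC.step.finite hB) rfl
      exact ⟨D, .head hC.step hD, hD'⟩
    -- If no step with priority for foldings is possible, then `B` is deterministic, so the priority
    -- does not restrict expansions and `B` is complete.
    · have hdet : B.Deterministic := by
        intro u x v v' e e'
        by_contra hne
        exact h ⟨_, Or.inl (.mk B u x v v' e e' hne)⟩
      exact ⟨B, .refl, fun C hC => h ⟨C, hC.imp id fun hC => ⟨hdet, hC⟩⟩⟩

end Automaton

/-! ### Finite graphs given by lists of edges -/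

section EdgeList

variable {A : Type*}

/-- The initial vertex of the edge `e`, read in the direction given by `b`. -/
def edgeSource (e : ℕ × A × ℕ) (b : Bool) : ℕ := cond b e.1 e.2.2

/-- The terminal vertex of the edge `e`, read in the direction given by `b`. -/
def edgeTarget (e : ℕ × A × ℕ) (b : Bool) : ℕ := cond b e.2.2 e.1

/-- The graph on `ℕ` with a list of positively labeled edges. -/
def edgeListGraph (E : List (ℕ × A × ℕ)) : LabeledGraph A where
  V := ℕ
  edge p x q := ∃ e ∈ E, e.2.1 = x.1 ∧ edgeSource e x.2 = p ∧ edgeTarget e x.2 = q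
  edge_inv := by
    rintro p ⟨a, b⟩ q ⟨e, he, rfl, rfl, rfl⟩
    exact ⟨e, he, rfl, by cases b <;> rfl, by cases b <;> rfl⟩

/-- The graph on `0, …, n - 1` with a list of positively labeled edges. -/
def codeGraph (n : ℕ) (E : List (ℕ × A × ℕ)) : LabeledGraph A where
  V := Fin n
  edge p x q := (edgeListGraph E).edge (p : ℕ) x (q : ℕ)
  edge_inv _ _ _ h := (edgeListGraph E).edge_inv _ _ _ h

theorem codeGraph_edge_true {n : ℕ} {E : List (ℕ × A × ℕ)} {p q : Fin n} {a : A} :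
    (codeGraph n E).edge p (a, true) q ↔ ((p : ℕ), a, (q : ℕ)) ∈ E := by
  constructor
  · rintro ⟨⟨p', a', q'⟩, he, rfl, h1, h2⟩
    change p' = p at h1
    change q' = q at h2
    rwa [← h1, ← h2]
  · exact fun h => ⟨_, h, rfl, rfl, rfl⟩

theorem edgeListGraph_edge_lt {n : ℕ} {E : List (ℕ × A × ℕ)}
    (hE : ∀ e ∈ E, e.1 < n ∧ e.2.2 < n) {p q : ℕ} {x : A × Bool}
    (h : (edgeListGraph E).edge p x q) : q < n := by
  obtain ⟨e, he, -, -, rfl⟩ := h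
  rcases x with ⟨a, _ | _⟩
  · exact (hE e he).1
  · exact (hE e he).2

/-- The bound on the edges keeps every path that starts below `n` below `n`, so computations can use
plain natural numbers. -/
theorem codeGraph_path_iff {n : ℕ} {E : List (ℕ × A × ℕ)} (hE : ∀ e ∈ E, e.1 < n ∧ e.2.2 < n)
    {q : Fin n} : ∀ {w : Word A} {p : Fin n},
      (codeGraph n E).Path p w q ↔ (edgeListGraph E).Path (p : ℕ) w (q : ℕ)
  | [], _ => Fin.ext_iff
  | x :: w, p => by
    constructor
    · rintro ⟨s, hs, h⟩
      exact ⟨_, hs, (codeGraph_path_iff hE).1 h⟩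
    · rintro ⟨s, hs, h⟩
      have hsn := edgeListGraph_edge_lt hE hs
      exact ⟨⟨s, hsn⟩, hs, (codeGraph_path_iff hE (p := ⟨s, hsn⟩)).2 h⟩

open Classical in
/-- The end points of the edges labeled `x` that start in `S`. -/
noncomputable def successors (E : List (ℕ × A × ℕ)) (S : List ℕ) (x : A × Bool) : List ℕ :=
  E.filterMap fun e =>
    if e.2.1 = x.1 ∧ edgeSource e x.2 ∈ S then some (edgeTarget e x.2) else none

/-- The end points of the paths labeled `w` that start at `p`. -/
noncomputable def endpoints (E : List (ℕ × A × ℕ)) (p : ℕ) (w : Word A) : List ℕ :=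
  w.foldl (successors E) [p]

theorem mem_foldl_successors {E : List (ℕ × A × ℕ)} {q : ℕ} : ∀ {w : Word A} {S : List ℕ},
    q ∈ w.foldl (successors E) S ↔ ∃ p ∈ S, (edgeListGraph E).Path p w q
  | [], S => ⟨fun h => ⟨q, h, rfl⟩, by rintro ⟨_, h, rfl⟩; exact h⟩
  | x :: w, S => by
    rw [List.foldl_cons, mem_foldl_successors]
    constructor
    · rintro ⟨s, hs, h⟩
      obtain ⟨e, he, hs⟩ := List.mem_filterMap.1 hs
      split_ifs at hs with hc
      exact ⟨_, hc.2, s, ⟨e, he, hc.1, rfl, Option.some.inj hs⟩, h⟩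
    · rintro ⟨p, hp, s, ⟨e, he, h1, rfl, rfl⟩, h⟩
      exact ⟨_, List.mem_filterMap.2 ⟨e, he, if_pos ⟨h1, hp⟩⟩, h⟩

theorem mem_endpoints {E : List (ℕ × A × ℕ)} {p q : ℕ} {w : Word A} :
    q ∈ endpoints E p w ↔ (edgeListGraph E).Path p w q := by
  simp [endpoints, mem_foldl_successors]

theorem lt_of_mem_endpoints {n : ℕ} {E : List (ℕ × A × ℕ)}
    (hE : ∀ e ∈ E, e.1 < n ∧ e.2.2 < n) {p q : ℕ} {w : Word A} (hp : p < n)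
    (h : q ∈ endpoints E p w) : q < n := by
  rw [mem_endpoints] at h
  cases w using List.reverseRecOn with
  | nil =>
    obtain rfl : p = q := h
    exact hp
  | append_singleton w x =>
    obtain ⟨s, -, h⟩ := LabeledGraph.path_append_iff.1 h
    exact edgeListGraph_edge_lt hE (LabeledGraph.path_singleton.1 h)

end EdgeList

/-! ### Certificates -/

section Certificate

variable {X P : Type*}

/-- For fixed `bl` the rules form a constant finite list, over which a checker can quantify. -/
theorem rewrite_finite [Finite X] [Finite P] (bl : P → Word X) :
    {t : Word (X ⊕ P) × Word (X ⊕ P) | Rewrite bl t.1 t.2}.Finite := by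
  have h1 := Set.finite_range fun x : (X ⊕ P) × Bool => (([x, invLetter x], []) : Word (X ⊕ P) × Word (X ⊕ P))
  have h2 := Set.finite_range fun y : P × Bool =>
    (([(Sum.inr y.1, y.2)], []) : Word (X ⊕ P) × Word (X ⊕ P))
  have h3 := Set.finite_range fun ρ : P => (([(Sum.inr ρ, true)], liftWord P (bl ρ)) : Word (X ⊕ P) × _)
  have h4 := Set.finite_range fun ρ : P =>
    (([(Sum.inr ρ, false)], invRev (liftWord P (bl ρ))) : Word (X ⊕ P) × _)
  refine (((h1.union h2).union h3).union h4).subset ?_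
  rintro ⟨m, m'⟩ h
  cases h with
  | cancel x => exact Or.inl (Or.inl (Or.inl ⟨x, rfl⟩))
  | erase ρ b => exact Or.inl (Or.inl (Or.inr ⟨(ρ, b), rfl⟩))
  | boundary ρ => exact Or.inl (Or.inr ⟨ρ, rfl⟩)
  | boundary_inv ρ => exact Or.inr ⟨ρ, rfl⟩

/-- The list of all rewriting rules. -/
noncomputable def rewriteList [Finite X] [Finite P] (bl : P → Word X) :
    List (Word (X ⊕ P) × Word (X ⊕ P)) := (rewrite_finite bl).toFinset.toList

variable [Finite X] [Finite P] {bl : P → Word X}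

theorem mem_rewriteList {t : Word (X ⊕ P) × Word (X ⊕ P)} :
    t ∈ rewriteList bl ↔ Rewrite bl t.1 t.2 := by
  simp [rewriteList]

/-- An instruction `(u, m, m', v)`: replace `u m v` by `u m' v`. -/
abbrev Instruction (A : Type*) : Type _ := Word A × Word A × Word A × Word A

/-- The instruction `i` can be applied to the word `w`. -/
def Applicable (bl : P → Word X) (Y : List (Word (X ⊕ P))) (w : Word (X ⊕ P))
    (i : Instruction (X ⊕ P)) : Prop :=
  w = i.1 ++ i.2.1 ++ i.2.2.2 ∧ ((i.2.1, i.2.2.1) ∈ rewriteList bl ∨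
    (i.2.1 = [] ∧ i.2.2.2 = [] ∧ (i.2.2.1 ∈ Y ∨ invRev i.2.2.1 ∈ Y)))

open Classical in
/-- Apply the instruction `i` to the word `w` if this is possible. -/
noncomputable def applyInstruction (bl : P → Word X) (Y : List (Word (X ⊕ P)))
    (w : Word (X ⊕ P)) (i : Instruction (X ⊕ P)) : Word (X ⊕ P) :=
  if Applicable bl Y w i then i.1 ++ i.2.2.1 ++ i.2.2.2 else w

/-- The word derived by a list of instructions. -/
noncomputable def derive (bl : P → Word X) (Y : List (Word (X ⊕ P)))
    (l : List (Instruction (X ⊕ P))) : Word (X ⊕ P) := l.foldl (applyInstruction bl Y) []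

/-- Instructions that do not apply leave the word unchanged, so an arbitrary list of instructions is
a valid proof of derivability. -/
theorem derivable_derive (Y : List (Word (X ⊕ P))) (l : List (Instruction (X ⊕ P))) :
    Derivable bl {y | y ∈ Y} (derive bl Y l) := by
  induction l using List.reverseRecOn with
  | nil => exact .nil
  | append_singleton l i ih =>
    rw [derive, List.foldl_append]
    change Derivable bl _ (applyInstruction bl Y (derive bl Y l) i)
    rw [applyInstruction]
    split_ifs with h
    · obtain ⟨u, m, m', v⟩ := i
      obtain ⟨h1, h2⟩ := h
      dsimp only at h1 h2 ⊢
      rw [h1] at ih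
      rcases h2 with h2 | ⟨rfl, rfl, h2⟩
      · exact ih.rewrite _ _ (mem_rewriteList.1 h2)
      · simp only [List.append_nil] at ih ⊢
        rcases h2 with h2 | h2
        · exact ih.mul h2
        · simpa using ih.mul_inv (y := invRev m') h2
    · exact ih

theorem exists_derive {Y : List (Word (X ⊕ P))} {w : Word (X ⊕ P)}
    (h : Derivable bl {y | y ∈ Y} w) : ∃ l, derive bl Y l = w := by
  have step : ∀ i : Instruction (X ⊕ P), (∃ l, derive bl Y l = i.1 ++ i.2.1 ++ i.2.2.2) →
      Applicable bl Y (i.1 ++ i.2.1 ++ i.2.2.2) i →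
      ∃ l, derive bl Y l = i.1 ++ i.2.2.1 ++ i.2.2.2 := by
    rintro i ⟨l, hl⟩ hi
    refine ⟨l ++ [i], ?_⟩
    rw [derive, List.foldl_append]
    change applyInstruction bl Y (derive bl Y l) i = _
    rw [hl, applyInstruction, if_pos hi]
  induction h with
  | nil => exact ⟨[], rfl⟩
  | @mul w y _ hy ih =>
    simpa using step (w, [], y, []) (by simpa using ih) ⟨rfl, Or.inr ⟨rfl, rfl, Or.inl hy⟩⟩
  | @mul_inv w y _ hy ih =>
    simpa using step (w, [], invRev y, []) (by simpa using ih)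
      ⟨rfl, Or.inr ⟨rfl, rfl, Or.inr (by simpa using hy)⟩⟩
  | @rewrite u m m' v hr _ ih =>
    exact step (u, m, m', v) ih ⟨rfl, Or.inl (mem_rewriteList.2 hr)⟩

/-- A finite graph with base point `0`, given by its number of vertices and its edges, together with
labels of paths from the base point to the vertices, and with derivations. -/
abbrev GraphCert (A : Type*) : Type _ :=
  (ℕ × List (ℕ × A × ℕ)) × List (Word A) × List (List (Instruction A))

/-- The label of a path from the base point to `p`. -/
def GraphCert.word {A : Type*} (c : GraphCert A) (p : ℕ) : Word A := c.2.1.getD p []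

/-- The certificate shows that its graph is the `ω`-coset graph of the closed inverse submonoid
generated by `Y`. -/
structure Certifies (bl : P → Word X) (Y : List (Word (X ⊕ P))) (c : GraphCert (X ⊕ P)) :
    Prop where
  pos : 0 < c.1.1
  edge_lt : ∀ e ∈ c.1.2, e.1 < c.1.1 ∧ e.2.2 < c.1.1
  rewrite_closed : ∀ p < c.1.1, ∀ t ∈ rewriteList bl, ∀ q ∈ endpoints c.1.2 p t.1,
    q ∈ endpoints c.1.2 p t.2
  loop : ∀ y ∈ Y, 0 ∈ endpoints c.1.2 0 y
  word_zero : c.word 0 = []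
  path : ∀ p < c.1.1, p ∈ endpoints c.1.2 0 (c.word p)
  derivation : ∀ e ∈ c.1.2, ∃ l ∈ c.2.2,
    derive bl Y l = c.word e.1 ++ [(e.2.1, true)] ++ invRev (c.word e.2.2)

/-- The closed inverse submonoid generated by a list of words. -/
abbrev listClosure (bl : P → Word X) (Y : List (Word (X ⊕ P))) :
    ClosedInverseSubmonoid (MXP bl) := ClosedInverseSubmonoid.closure (MXP.mk bl '' {w | w ∈ Y})

/-- The certificate derives `c_p x c_q⁻¹` for each positive edge, where `c_p` is the chosen word for
`p`; inverse edges follow by inversion. Along a path these words telescope to the label followed by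
the inverse of the word chosen for the end point. -/
theorem Certifies.derivable {Y : List (Word (X ⊕ P))} {c : GraphCert (X ⊕ P)}
    (hc : Certifies bl Y c) (w : Word (X ⊕ P)) : ∀ p : ℕ, (edgeListGraph c.1.2).Path (0 : ℕ) w p →
      Derivable bl {y | y ∈ Y} (w ++ invRev (c.word p)) := by
  have hedge : ∀ p x q, (edgeListGraph c.1.2).edge p x q →
      Derivable bl {y | y ∈ Y} (c.word p ++ [x] ++ invRev (c.word q)) := by
    rintro _ ⟨a, b⟩ _ ⟨e, he, rfl, rfl, rfl⟩
    obtain ⟨l, -, hl⟩ := hc.derivation e he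
    have h := derivable_derive (bl := bl) Y l
    rw [hl] at h
    cases b
    · have := h.invRev
      simp only [invRev_append, invRev_invRev, ← List.append_assoc] at this
      simpa [FreeGroup.invRev, edgeSource, edgeTarget] using this
    · exact h
  induction w using List.reverseRecOn with
  | nil =>
    rintro p (rfl : 0 = p)
    rw [hc.word_zero]
    exact .nil
  | append_singleton w x ih =>
    intro q h
    obtain ⟨p, hp, hpq⟩ := LabeledGraph.path_append_iff.1 h
    have := (ih p hp).append (hedge _ _ _ (LabeledGraph.path_singleton.1 hpq))
    simp only [List.append_assoc] at this
    have := Derivable.cancel' _ this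
    simpa only [List.append_assoc] using this

/-- Soundness of certificates: the derivations show that every closed path at `0` lies in the
submonoid, while closure under the rules and the loops in `Y` make every derivable word a closed
path. -/
theorem Certifies.exists_equiv {Y : List (Word (X ⊕ P))} {c : GraphCert (X ⊕ P)}
    (hc : Certifies bl Y c) {G : LabeledGraph (X ⊕ P)} (hG : G.Deterministic) {p : G.V}
    (hp : G.ReachableFrom p) (hl : ∀ w, G.Path p w p ↔ MXP.mk bl w ∈ (listClosure bl Y).carrier) :
    ∃ f : Fin c.1.1 ≃ G.V, f ⟨0, hc.pos⟩ = p ∧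
      (∀ w q, q ∈ endpoints c.1.2 0 w ↔ ∃ h : q < c.1.1, G.Path p w (f ⟨q, h⟩)) ∧
      ∀ q a r, (q, a, r) ∈ c.1.2 ↔ ∃ (hq : q < c.1.1) (hr : r < c.1.1),
        G.edge (f ⟨q, hq⟩) (a, true) (f ⟨r, hr⟩) := by
  have hpath : ∀ {q r w}, (codeGraph c.1.1 c.1.2).Path q w r ↔ r.1 ∈ endpoints c.1.2 q.1 w :=
    fun {q r w} => (codeGraph_path_iff hc.edge_lt).trans mem_endpoints.symm
  have hR : (codeGraph c.1.1 c.1.2).RewriteClosed bl := by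
    intro q m m' r hr h
    exact hpath.2 (hc.rewrite_closed _ q.2 (m, m') (mem_rewriteList.2 hr) _ (hpath.1 h))
  obtain ⟨f, h0, h1, h2⟩ := LabeledGraph.exists_equiv_of_loops hR.deterministic hG
    (p := (⟨0, hc.pos⟩ : Fin c.1.1)) (fun q => ⟨_, hpath.2 (hc.path q.1 q.2)⟩) hp fun w => by
      rw [hl, mk_mem_closure_iff]
      constructor
      · intro h
        have := hc.derivable w 0 (mem_endpoints.1 (hpath.1 h))
        rw [hc.word_zero] at this
        simpa using this
      · exact fun h => h.path hR fun y hy => hpath.2 (hc.loop y hy)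
  refine ⟨f, h0, fun w q => ?_, fun q a r => ?_⟩
  · constructor
    · intro h
      exact ⟨lt_of_mem_endpoints hc.edge_lt hc.pos h, (h1 _ _).1 (hpath.2 h)⟩
    · rintro ⟨h, hw⟩
      exact hpath.1 ((h1 _ _).2 hw)
  · constructor
    · intro h
      obtain ⟨hq, hr⟩ := hc.edge_lt _ h
      exact ⟨hq, hr, (h2 _ _ _).1 (codeGraph_edge_true.2 h)⟩
    · rintro ⟨hq, hr, h⟩
      exact (codeGraph_edge_true (p := ⟨q, hq⟩) (q := ⟨r, hr⟩)).1 ((h2 _ _ _).2 h)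

theorem finite_rightCoset {Y : Set (Word (X ⊕ P))} (hY : Y.Finite) :
    Finite (ClosedInverseSubmonoid.closure (MXP.mk bl '' Y)).RightCoset := by
  obtain ⟨B, hB, hc⟩ := Automaton.exists_complete (bl := bl) (Automaton.flower_finite hY)
  obtain ⟨⟨hfin, -⟩, f, -⟩ := complete_iso_coset hY hB hc
  exact Finite.of_equiv _ f

/-- The coset graph itself, which is finite, is numbered and equipped with words and derivations. -/
theorem exists_certifies (bl : P → Word X) (Y : List (Word (X ⊕ P))) :
    ∃ c, Certifies bl Y c := by
  set H := listClosure bl Y with hH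
  set G := (cosetAutomaton H).toLabeledGraph with hG
  have hfin : Finite G.V := finite_rightCoset Y.finite_toSet
  have hdet : G.Deterministic := cosetAutomaton_deterministic H
  have hcl : G.RewriteClosed bl := coset_rewriteClosed H
  let b : G.V := H.baseCoset
  have hloop : ∀ w, Derivable bl {y | y ∈ Y} w ↔ G.Path b w b := fun w => derivable_iff_coset_loop
  have : Nonempty G.V := ⟨b⟩
  have hn : 0 < Nat.card G.V := Nat.card_pos
  set n := Nat.card G.V
  -- A transposition turns an arbitrary numbering into one that gives the base coset the number `0`.
  obtain ⟨f, hf⟩ : ∃ f : Fin n ≃ G.V, f ⟨0, hn⟩ = b := by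
    let e : Fin n ≃ G.V := (Finite.equivFin G.V).symm
    exact ⟨(Equiv.swap ⟨0, hn⟩ (e.symm b)).trans e, by simp⟩
  have hEfin : {e : ℕ × (X ⊕ P) × ℕ | ∃ (h : e.1 < n) (h' : e.2.2 < n),
      G.edge (f ⟨_, h⟩) (e.2.1, true) (f ⟨_, h'⟩)}.Finite := by
    refine (Set.finite_range fun e : Fin n × (X ⊕ P) × Fin n => (e.1.1, e.2.1, e.2.2.1)).subset ?_
    rintro ⟨p, a, q⟩ ⟨h, h', -⟩
    exact ⟨(⟨p, h⟩, a, ⟨q, h'⟩), rfl⟩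
  set E := hEfin.toFinset.toList
  have hE : ∀ e, e ∈ E ↔ ∃ (h : e.1 < n) (h' : e.2.2 < n),
      G.edge (f ⟨_, h⟩) (e.2.1, true) (f ⟨_, h'⟩) := fun e => by simp [E]
  have hElt : ∀ e ∈ E, e.1 < n ∧ e.2.2 < n := fun e he => by
    obtain ⟨h, h', -⟩ := (hE e).1 he
    exact ⟨h, h'⟩
  have hedge : ∀ p x q, (codeGraph n E).edge p x q ↔ G.edge (f p) x (f q) := by
    have htrue : ∀ p a q, (codeGraph n E).edge p (a, true) q ↔ G.edge (f p) (a, true) (f q) := by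
      intro p a q
      refine codeGraph_edge_true.trans ((hE _).trans ?_)
      exact ⟨fun ⟨_, _, h⟩ => h, fun h => ⟨p.2, q.2, h⟩⟩
    rintro p ⟨a, _ | _⟩ q
    · exact ⟨fun h => G.edge_inv _ _ _ ((htrue _ _ _).1 ((codeGraph n E).edge_inv _ _ _ h)),
        fun h => (codeGraph n E).edge_inv _ _ _ ((htrue _ _ _).2 (G.edge_inv _ _ _ h))⟩
    · exact htrue p a q
  have hto : (codeGraph n E).IsHom G f := fun _ _ _ h => (hedge _ _ _).1 h
  have hfrom : G.IsHom (codeGraph n E) f.symm := fun _ _ _ h => (hedge _ _ _).2 (by simpa using h)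
  have hpath : ∀ {q r : Fin n} {w}, r.1 ∈ endpoints E q.1 w ↔ G.Path (f q) w (f r) := by
    intro q r w
    rw [mem_endpoints, ← codeGraph_path_iff hElt]
    refine ⟨hto.path, fun h => ?_⟩
    have := hfrom.path h
    rwa [f.symm_apply_apply, f.symm_apply_apply] at this
  have hword : ∀ p : Fin n, ∃ w, G.Path b w (f p) ∧ (p.1 = 0 → w = []) := by
    intro p
    by_cases h : p.1 = 0
    · obtain rfl : p = ⟨0, hn⟩ := Fin.ext h
      exact ⟨[], hf.symm, fun _ => rfl⟩
    · obtain ⟨w, hw⟩ := coset_reachable (H := H) (f p)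
      exact ⟨w, hw, fun h' => absurd h' h⟩
  choose c hc hc0 using hword
  -- Following the chosen path to the start of `e`, then `e`, then the chosen path back gives a
  -- closed path at the base coset, so its label is derivable.
  have hder : ∀ e, ∃ l, e ∈ E → derive bl Y l = (List.ofFn c).getD e.1 [] ++ [(e.2.1, true)] ++
      invRev ((List.ofFn c).getD e.2.2 []) := by
    intro e
    by_cases he : e ∈ E
    · obtain ⟨h, h', hG⟩ := (hE e).1 he
      obtain ⟨l, hl⟩ := exists_derive ((hloop (c ⟨_, h⟩ ++ [(e.2.1, true)] ++
        invRev (c ⟨_, h'⟩))).2 (((hc _).append (LabeledGraph.path_singleton.2 hG)).append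
          (hc _).invRev))
      refine ⟨l, fun _ => ?_⟩
      rw [hl]
      simp [h, h']
    · exact ⟨[], fun h => absurd h he⟩
  choose d hd using hder
  refine ⟨((n, E), List.ofFn c, E.map d), hn, hElt, ?_, ?_, ?_, ?_, ?_⟩
  · intro p hp t ht q hq
    have hqn := lt_of_mem_endpoints hElt hp hq
    exact (hpath (q := ⟨p, hp⟩) (r := ⟨q, hqn⟩)).2
      (hcl _ _ _ _ (mem_rewriteList.1 ht) ((hpath (q := ⟨p, hp⟩) (r := ⟨q, hqn⟩)).1 hq))
  · intro y hy
    refine (hpath (q := ⟨0, hn⟩) (r := ⟨0, hn⟩)).2 ?_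
    rw [hf]
    exact (hloop y).1 (by simpa using Derivable.nil.mul hy)
  · change (List.ofFn c).getD 0 [] = []
    simpa [hn] using hc0 ⟨0, hn⟩ rfl
  · intro p hp
    refine (hpath (q := ⟨0, hn⟩) (r := ⟨p, hp⟩)).2 ?_
    rw [hf]
    have : GraphCert.word ((n, E), List.ofFn c, E.map d) p = c ⟨p, hp⟩ := by
      simp [GraphCert.word, hp]
    rw [this]
    exact hc _
  · intro e he
    exact ⟨d e, List.mem_map_of_mem he, hd e he⟩

end Certificate

/-! ### Computability -/

section Computability

/-- Unbounded search. -/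
theorem exists_computable_of_primrecRel {α β : Type*} [Primcodable α] [Primcodable β]
    {Q : α → β → Prop} (hQ : PrimrecRel Q) (h : ∀ a, ∃ b, Q a b) :
    ∃ F : α → β, Computable F ∧ ∀ a, Q a (F a) := by
  classical
  -- Natural numbers are decoded as candidate witnesses, and `f a n` keeps the candidate only if it
  -- passes the test.
  let f : α → ℕ → Option β := fun a n =>
    (Encodable.decode n : Option β).bind fun b => if Q a b then some b else none
  have hf : Primrec₂ f := Primrec.option_bind (Primrec.decode.comp Primrec.snd)
    (Primrec.ite (hQ.comp (Primrec.fst.comp Primrec.fst) Primrec.snd)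
      (Primrec.option_some.comp Primrec.snd) (Primrec.const none))
  have hspec : ∀ a n b, b ∈ f a n → Q a b := by
    intro a n b hb
    obtain ⟨b', -, hb'⟩ := Option.bind_eq_some_iff.1 hb
    split_ifs at hb' with hc
    rwa [← Option.some.inj hb']
  have hdom : ∀ a, (Nat.rfindOpt (f a)).Dom := fun a => by
    obtain ⟨b, hb⟩ := h a
    exact Nat.rfindOpt_dom.2 ⟨Encodable.encode b, b, by simp [f, hb]⟩
  refine ⟨fun a => (Nat.rfindOpt (f a)).get (hdom a), ?_, fun a => ?_⟩
  · exact (Partrec.rfindOpt hf.to_comp).of_eq fun a => (Part.some_get (hdom a)).symm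
  · obtain ⟨n, hn⟩ := Nat.rfindOpt_spec (Part.get_mem (hdom a))
    exact hspec _ _ _ hn

theorem primrecRel_mem {α : Type*} [Primcodable α] :
    PrimrecRel fun (a : α) (L : List α) => a ∈ L :=
  PrimrecPred.of_eq ((PrimrecRel.exists_mem_list Primrec.eq).comp Primrec.snd Primrec.fst)
    fun p => by simp

section Lists

variable {α β : Type*} [Primcodable α] [Primcodable β]

theorem primrecPred_forall_mem {f : α → List β} {p : α → β → Prop} (hf : Primrec f)
    (hp : PrimrecRel p) : PrimrecPred fun a => ∀ b ∈ f a, p a b :=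
  (PrimrecRel.forall_mem_list (R := fun b a => p a b) hp.swap).comp hf Primrec.id

theorem primrecPred_exists_mem {f : α → List β} {p : α → β → Prop} (hf : Primrec f)
    (hp : PrimrecRel p) : PrimrecPred fun a => ∃ b ∈ f a, p a b :=
  (PrimrecRel.exists_mem_list (R := fun b a => p a b) hp.swap).comp hf Primrec.id

end Lists

/-! ### Primitive recursive operations on words and edge lists -/

section Words

variable {A : Type*} [Primcodable A]

theorem primrec_invRev : Primrec (FreeGroup.invRev : Word A → Word A) :=
  Primrec.list_reverse.comp (Primrec.list_map Primrec.id
    ((Primrec.fst.pair (Primrec.not.comp Primrec.snd)).comp Primrec.snd))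

theorem primrec_edgeSource : Primrec₂ (edgeSource : ℕ × A × ℕ → Bool → ℕ) :=
  Primrec.cond Primrec.snd (Primrec.fst.comp Primrec.fst)
    (Primrec.snd.comp (Primrec.snd.comp Primrec.fst))

theorem primrec_edgeTarget : Primrec₂ (edgeTarget : ℕ × A × ℕ → Bool → ℕ) :=
  Primrec.cond Primrec.snd (Primrec.snd.comp (Primrec.snd.comp Primrec.fst))
    (Primrec.fst.comp Primrec.fst)

theorem primrec_successors : Primrec fun t : List (ℕ × A × ℕ) × List ℕ × (A × Bool) =>
    successors t.1 t.2.1 t.2.2 := by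
  classical
  have e : Primrec fun u : (List (ℕ × A × ℕ) × List ℕ × (A × Bool)) × (ℕ × A × ℕ) => u.2 :=
    Primrec.snd
  have hS : Primrec fun u : (List (ℕ × A × ℕ) × List ℕ × (A × Bool)) × (ℕ × A × ℕ) => u.1.2.1 :=
    Primrec.fst.comp (Primrec.snd.comp Primrec.fst)
  have x : Primrec fun u : (List (ℕ × A × ℕ) × List ℕ × (A × Bool)) × (ℕ × A × ℕ) => u.1.2.2 :=
    Primrec.snd.comp (Primrec.snd.comp Primrec.fst)
  have hb := Primrec.snd.comp x
  have hpred : PrimrecPred fun u : (List (ℕ × A × ℕ) × List ℕ × (A × Bool)) × (ℕ × A × ℕ) =>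
      u.2.2.1 = u.1.2.2.1 ∧ edgeSource u.2 u.1.2.2.2 ∈ u.1.2.1 :=
    PrimrecPred.and (Primrec.eq.comp (Primrec.fst.comp (Primrec.snd.comp e)) (Primrec.fst.comp x))
      (primrecRel_mem.comp (primrec_edgeSource.comp e hb) hS)
  have hite := Primrec.ite hpred (Primrec.option_some.comp (primrec_edgeTarget.comp e hb))
    (Primrec.const none)
  refine (Primrec.listFilterMap Primrec.fst hite.to₂).of_eq fun t => ?_
  unfold successors
  congr

theorem primrec_endpoints {α : Type*} [Primcodable α] {E : α → List (ℕ × A × ℕ)} {p : α → ℕ}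
    {w : α → Word A} (hE : Primrec E) (hp : Primrec p) (hw : Primrec w) :
    Primrec fun a => endpoints (E a) (p a) (w a) :=
  Primrec.list_foldl hw (Primrec.list_cons.comp hp (Primrec.const []))
    (h := fun a t => successors (E a) t.1 t.2)
    (primrec_successors.comp ((hE.comp Primrec.fst).pair
      ((Primrec.fst.comp Primrec.snd).pair (Primrec.snd.comp Primrec.snd)))).to₂

end Words

/-! ### Primitive recursive checking of certificates -/

section Certificates

/-- All quantifiers are written over lists (bounds `p < n` as membership in `List.range n`), the
form in which they preserve primitive recursiveness. -/
theorem certifies_iff {X P : Type*} [Finite X] [Finite P] {bl : P → Word X} {Y : List (Word (X ⊕ P))} {c : GraphCert (X ⊕ P)} :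
    Certifies bl Y c ↔ 0 < c.1.1 ∧ (∀ e ∈ c.1.2, e.1 < c.1.1 ∧ e.2.2 < c.1.1) ∧
      (∀ p ∈ List.range c.1.1, ∀ t ∈ rewriteList bl, ∀ q ∈ endpoints c.1.2 p t.1,
        q ∈ endpoints c.1.2 p t.2) ∧
      (∀ y ∈ Y, 0 ∈ endpoints c.1.2 0 y) ∧ c.word 0 = [] ∧
      (∀ p ∈ List.range c.1.1, p ∈ endpoints c.1.2 0 (c.word p)) ∧
      ∀ e ∈ c.1.2, ∃ l ∈ c.2.2,
        derive bl Y l = c.word e.1 ++ [(e.2.1, true)] ++ invRev (c.word e.2.2) := by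
  simp only [List.mem_range]
  exact ⟨fun ⟨h1, h2, h3, h4, h5, h6, h7⟩ => ⟨h1, h2, h3, h4, h5, h6, h7⟩,
    fun ⟨h1, h2, h3, h4, h5, h6, h7⟩ => ⟨h1, h2, h3, h4, h5, h6, h7⟩⟩

variable {X P : Type*} [Finite X] [Finite P] [Primcodable X] [Primcodable P] (bl : P → Word X)

theorem primrec_applyInstruction :
    Primrec fun t : List (Word (X ⊕ P)) × Word (X ⊕ P) × Instruction (X ⊕ P) =>
      applyInstruction bl t.1 t.2.1 t.2.2 := by
  classical
  have hw : Primrec fun t : List (Word (X ⊕ P)) × Word (X ⊕ P) × Instruction (X ⊕ P) => t.2.1 :=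
    Primrec.fst.comp Primrec.snd
  have hi : Primrec fun t : List (Word (X ⊕ P)) × Word (X ⊕ P) × Instruction (X ⊕ P) => t.2.2 :=
    Primrec.snd.comp Primrec.snd
  have hu := Primrec.fst.comp hi
  have hm := Primrec.fst.comp (Primrec.snd.comp hi)
  have hm' := Primrec.fst.comp (Primrec.snd.comp (Primrec.snd.comp hi))
  have hv := Primrec.snd.comp (Primrec.snd.comp (Primrec.snd.comp hi))
  have happ : PrimrecPred fun t : List (Word (X ⊕ P)) × Word (X ⊕ P) × Instruction (X ⊕ P) =>
      Applicable bl t.1 t.2.1 t.2.2 := by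
    refine PrimrecPred.and ?_ (PrimrecPred.or ?_ (PrimrecPred.and ?_ (PrimrecPred.and ?_
      (PrimrecPred.or ?_ ?_))))
    · exact Primrec.eq.comp hw (Primrec.list_append.comp (Primrec.list_append.comp hu hm) hv)
    · exact primrecRel_mem.comp (hm.pair hm') (Primrec.const _)
    · exact Primrec.eq.comp hm (Primrec.const _)
    · exact Primrec.eq.comp hv (Primrec.const _)
    · exact primrecRel_mem.comp hm' Primrec.fst
    · exact primrecRel_mem.comp (primrec_invRev.comp hm') Primrec.fst
  exact (Primrec.ite happ (Primrec.list_append.comp (Primrec.list_append.comp hu hm') hv) hw).of_eq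
    fun t => by unfold applyInstruction; congr

theorem primrec_derive : Primrec₂ (derive bl) :=
  Primrec.list_foldl Primrec.snd (Primrec.const [])
    (h := fun (a : List (Word (X ⊕ P)) × List (Instruction (X ⊕ P)))
      (t : Word (X ⊕ P) × Instruction (X ⊕ P)) => applyInstruction bl a.1 t.1 t.2)
    ((primrec_applyInstruction bl).comp ((Primrec.fst.comp Primrec.fst).pair Primrec.snd)).to₂

theorem primrec_word {A : Type*} [Primcodable A] :
    Primrec₂ (GraphCert.word : GraphCert A → ℕ → Word A) :=
  (Primrec.list_getD []).comp (Primrec.fst.comp (Primrec.snd.comp Primrec.fst)) Primrec.snd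

theorem primrecRel_certifies : PrimrecRel (Certifies bl) := by
  refine PrimrecRel.of_eq ?_ fun Y c => certifies_iff.symm
  have hc : Primrec fun t : List (Word (X ⊕ P)) × GraphCert (X ⊕ P) => t.2 := Primrec.snd
  have hn := Primrec.fst.comp (Primrec.fst.comp hc)
  have hE := Primrec.snd.comp (Primrec.fst.comp hc)
  refine PrimrecPred.and ?_ (PrimrecPred.and ?_ (PrimrecPred.and ?_ (PrimrecPred.and ?_
    (PrimrecPred.and ?_ (PrimrecPred.and ?_ ?_)))))
  · exact Primrec.nat_lt.comp (Primrec.const 0) hn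
  · refine primrecPred_forall_mem hE (PrimrecPred.and ?_ ?_)
    · exact Primrec.nat_lt.comp (Primrec.fst.comp Primrec.snd) (hn.comp Primrec.fst)
    · exact Primrec.nat_lt.comp (Primrec.snd.comp (Primrec.snd.comp Primrec.snd))
        (hn.comp Primrec.fst)
  · refine primrecPred_forall_mem (Primrec.list_range.comp hn)
      (primrecPred_forall_mem (Primrec.const _) (primrecPred_forall_mem
        (primrec_endpoints ?_ ?_ ?_) (primrecRel_mem.comp Primrec.snd (primrec_endpoints ?_ ?_ ?_))))
    · exact hE.comp (Primrec.fst.comp Primrec.fst)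
    · exact Primrec.snd.comp Primrec.fst
    · exact Primrec.fst.comp Primrec.snd
    · exact hE.comp (Primrec.fst.comp (Primrec.fst.comp Primrec.fst))
    · exact Primrec.snd.comp (Primrec.fst.comp Primrec.fst)
    · exact Primrec.snd.comp (Primrec.snd.comp Primrec.fst)
  · exact primrecPred_forall_mem Primrec.fst (primrecRel_mem.comp (Primrec.const 0)
      (primrec_endpoints (hE.comp Primrec.fst) (Primrec.const 0) Primrec.snd))
  · exact Primrec.eq.comp (primrec_word.comp hc (Primrec.const 0)) (Primrec.const _)
  · exact primrecPred_forall_mem (Primrec.list_range.comp hn) (primrecRel_mem.comp Primrec.snd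
      (primrec_endpoints (hE.comp Primrec.fst) (Primrec.const 0)
        (primrec_word.comp (hc.comp Primrec.fst) Primrec.snd)))
  · refine primrecPred_forall_mem hE (primrecPred_exists_mem
      (Primrec.snd.comp (Primrec.snd.comp (hc.comp Primrec.fst))) ?_)
    have hY : Primrec fun t : ((List (Word (X ⊕ P)) × GraphCert (X ⊕ P)) × (ℕ × (X ⊕ P) × ℕ)) ×
        List (Instruction (X ⊕ P)) => t.1.1.1 :=
      Primrec.fst.comp (Primrec.fst.comp Primrec.fst)
    have hc' : Primrec fun t : ((List (Word (X ⊕ P)) × GraphCert (X ⊕ P)) × (ℕ × (X ⊕ P) × ℕ)) ×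
        List (Instruction (X ⊕ P)) => t.1.1.2 :=
      Primrec.snd.comp (Primrec.fst.comp Primrec.fst)
    have he : Primrec fun t : ((List (Word (X ⊕ P)) × GraphCert (X ⊕ P)) × (ℕ × (X ⊕ P) × ℕ)) ×
        List (Instruction (X ⊕ P)) => t.1.2 := Primrec.snd.comp Primrec.fst
    exact Primrec.eq.comp ((primrec_derive bl).comp hY Primrec.snd) (Primrec.list_append.comp
      (Primrec.list_append.comp (primrec_word.comp hc' (Primrec.fst.comp he))
        (Primrec.list_cons.comp ((Primrec.fst.comp (Primrec.snd.comp he)).pair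
          (Primrec.const true)) (Primrec.const [])))
      (primrec_invRev.comp (primrec_word.comp hc' (Primrec.snd.comp (Primrec.snd.comp he)))))

theorem exists_computable_certificate : ∃ F : List (Word (X ⊕ P)) → GraphCert (X ⊕ P),
    Computable F ∧ ∀ Y, Certifies bl Y (F Y) :=
  exists_computable_of_primrecRel (primrecRel_certifies bl) (exists_certifies bl)

end Certificates

/-- The part of a list of edges labeled over `X`. -/
def leftEdges {X P : Type*} (E : List (ℕ × (X ⊕ P) × ℕ)) : List (ℕ × X × ℕ) :=
  E.filterMap fun e => Sum.casesOn e.2.1 (fun x => some (e.1, x, e.2.2)) fun _ => none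

/-- The roots and labels of the edges labeled over `P`. -/
def rightEdges {X P : Type*} (E : List (ℕ × (X ⊕ P) × ℕ)) : List (ℕ × P) :=
  E.filterMap fun e => Sum.casesOn e.2.1 (fun _ => none) fun ρ => some (e.1, ρ)

section

variable {X P : Type*}

theorem mem_leftEdges {E : List (ℕ × (X ⊕ P) × ℕ)} {p q : ℕ} {x : X} :
    (p, x, q) ∈ leftEdges E ↔ (p, Sum.inl x, q) ∈ E := by
  rw [leftEdges, List.mem_filterMap]
  constructor
  · rintro ⟨⟨p', x' | ρ, q'⟩, he, h⟩
    · cases h; exact he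
    · cases h
  · exact fun h => ⟨_, h, rfl⟩

theorem mem_rightEdges {E : List (ℕ × (X ⊕ P) × ℕ)} {p : ℕ} {ρ : P} :
    (p, ρ) ∈ rightEdges E ↔ ∃ q, (p, Sum.inr ρ, q) ∈ E := by
  rw [rightEdges, List.mem_filterMap]
  constructor
  · rintro ⟨⟨p', x' | ρ, q'⟩, he, h⟩
    · cases h
    · cases h; exact ⟨_, he⟩
  · exact fun ⟨q, h⟩ => ⟨_, h, rfl⟩

variable [Primcodable X] [Primcodable P]

theorem primrec_leftEdges : Primrec (leftEdges (X := X) (P := P)) := by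
  refine Primrec.listFilterMap Primrec.id (Primrec.sumCasesOn ?_ ?_ (Primrec.const none).to₂)
  · exact Primrec.fst.comp (Primrec.snd.comp Primrec.snd)
  · exact Primrec.option_some.comp ((Primrec.fst.comp (Primrec.snd.comp Primrec.fst)).pair
      (Primrec.snd.pair (Primrec.snd.comp (Primrec.snd.comp (Primrec.snd.comp Primrec.fst)))))

theorem primrec_rightEdges : Primrec (rightEdges (X := X) (P := P)) := by
  refine Primrec.listFilterMap Primrec.id (Primrec.sumCasesOn ?_ (Primrec.const none).to₂ ?_)
  · exact Primrec.fst.comp (Primrec.snd.comp Primrec.snd)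
  · exact Primrec.option_some.comp ((Primrec.fst.comp (Primrec.snd.comp Primrec.fst)).pair
      Primrec.snd)

end

end Computability

/-! ### Proof of the main theorem -/

section Main

variable {X P : Type*} {bl : P → Word X}

theorem listClosure_singleton (w : Word (X ⊕ P)) : listClosure bl [w ++ invRev w] =
    ClosedInverseSubmonoid.closure {MXP.mk bl w * (MXP.mk bl w)⁻¹} := by
  have : {u | u ∈ [w ++ invRev w]} = {w ++ invRev w} := by ext; simp
  rw [listClosure, this, Set.image_singleton, MXP.mk, InvPresentation.mk_append,
    ← InvPresentation.mk_inv]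

variable [Finite X] [Finite P]

theorem Certifies.describes_schutzenberger {w : Word (X ⊕ P)} {c : GraphCert (X ⊕ P)}
    (hc : Certifies bl [w ++ invRev w] c) :
    AutomatonCode.Describes (c.1.1, c.1.2, 0, (endpoints c.1.2 0 w).headI)
      (schutzenbergerAutomaton (MXP.mk bl w)) := by
  have hdet := schutzenberger_deterministic (MXP.mk bl w)
  obtain ⟨f, h0, h1, h2⟩ := hc.exists_equiv hdet (schutzenberger_reachable (MXP.mk bl w)) (by
    intro u
    rw [listClosure_singleton, schutzenberger_loop_iff])
  refine ⟨f, h2, ?_, ?_⟩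
  · rw [← h0, Equiv.symm_apply_apply]
  · obtain ⟨r, hr⟩ : ∃ r, f r = (schutzenbergerAutomaton (MXP.mk bl w)).terminal :=
      f.surjective _
    have hself := schutzenberger_path_self (R := CellRel bl) w
    -- By determinism all entries of the list equal the terminal vertex, and the list is nonempty
    -- since `w` can be read from the initial vertex; so `headI` never returns its default value.
    have hmem : ∀ q, q ∈ endpoints c.1.2 0 w ↔ q = r.1 := by
      intro q
      rw [h1]
      constructor
      · rintro ⟨hq, h⟩
        have := f.injective ((hdet.path_unique h hself).trans hr.symm)
        exact congrArg Fin.val this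
      · rintro rfl
        refine ⟨r.2, ?_⟩
        rw [Fin.eta, hr]
        exact hself
    rw [← hr, Equiv.symm_apply_apply]
    change r.1 = (endpoints c.1.2 0 w).headI
    cases hl : endpoints c.1.2 0 w with
    | nil => exact absurd ((hmem r.1).2 rfl) (by simp [hl])
    | cons q l => exact ((hmem q).1 (by simp [hl])).symm

/-- The `1`-cells and `2`-cells are the edges of the coset graph labeled over `X` and over `P`, so
splitting the certified edge list describes both. -/
theorem Certifies.describes_cosetComplex {Y : List (Word (X ⊕ P))} {c : GraphCert (X ⊕ P)}
    (hc : Certifies bl Y c) : ComplexCode.Describes (c.1.1, leftEdges c.1.2, rightEdges c.1.2)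
      (cosetComplex (listClosure bl Y)) := by
  obtain ⟨f, h0, h1, h2⟩ := hc.exists_equiv (cosetAutomaton_deterministic (listClosure bl Y))
    coset_reachable (fun w => coset_loop_iff)
  refine ⟨f, fun p x q => mem_leftEdges.trans (h2 _ _ _), fun p ρ => mem_rightEdges.trans ?_⟩
  constructor
  · rintro ⟨q, h⟩
    obtain ⟨hp, hq, h⟩ := (h2 _ _ _).1 h
    exact ⟨hp, ⟨(_, ρ, _), h⟩, rfl, rfl⟩
  · rintro ⟨hp, ⟨⟨S, ρ', T⟩, h⟩, hS, hρ⟩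
    obtain rfl : S = f ⟨p, hp⟩ := hS
    obtain rfl : ρ' = ρ := hρ
    obtain ⟨q, rfl⟩ := f.surjective T
    exact ⟨q.1, (h2 _ _ _).2 ⟨hp, q.2, h⟩⟩

theorem Certifies.mem_iff {Y : List (Word (X ⊕ P))} {c : GraphCert (X ⊕ P)}
    (hc : Certifies bl Y c) (w : Word (X ⊕ P)) :
    0 ∈ endpoints c.1.2 0 w ↔ MXP.mk bl w ∈ (listClosure bl Y).carrier := by
  obtain ⟨f, h0, h1, -⟩ := hc.exists_equiv (cosetAutomaton_deterministic (listClosure bl Y))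
    coset_reachable (fun w => coset_loop_iff)
  rw [h1, ← coset_loop_iff, ← h0]
  exact ⟨fun ⟨_, h⟩ => h, fun h => ⟨hc.pos, h⟩⟩

theorem finite_schutzenberger (m : MXP bl) : (schutzenbergerAutomaton m).IsFinite := by
  obtain ⟨w, rfl⟩ := InvPresentation.mk_surjective m
  obtain ⟨c, hc⟩ := exists_certifies bl [w ++ invRev w]
  obtain ⟨f, -⟩ := hc.describes_schutzenberger
  exact LabeledGraph.isFinite_of_finite _ (Finite.of_equiv _ f)

theorem finite_cosetComplex {H : ClosedInverseSubmonoid (MXP bl)} (hH : H.FG) :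
    (cosetComplex H).IsFinite := by
  obtain ⟨S, hS, rfl⟩ := hH
  -- One representing word is chosen for each generator.
  obtain ⟨Y, hY, rfl⟩ : ∃ Y : Set (Word (X ⊕ P)), Y.Finite ∧ MXP.mk bl '' Y = S :=
    ⟨Function.surjInv InvPresentation.mk_surjective '' S, hS.image _, by
      rw [Set.image_image]
      simp [MXP.mk, Function.surjInv_eq]⟩
  have hfin := finite_rightCoset (bl := bl) hY
  exact ⟨LabeledGraph.isFinite_of_finite _ hfin, Subtype.finite⟩

theorem computablePred_wordProblem [Primcodable X] [Primcodable P] :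
    ComputablePred fun p : Word (X ⊕ P) × Word (X ⊕ P) => MXP.mk bl p.1 = MXP.mk bl p.2 := by
  classical
  obtain ⟨F, hF, hc⟩ := exists_computable_certificate bl
  -- The order is decided by reading `v u⁻¹` in the certified graph for the generator `u u⁻¹` and
  -- testing whether the path closes up.
  have hle : ∀ u v : Word (X ⊕ P), NatLE (MXP.mk bl u) (MXP.mk bl v) ↔
      0 ∈ endpoints (F [u ++ invRev u]).1.2 0 (v ++ invRev u) := by
    intro u v
    rw [(hc _).mem_iff, listClosure_singleton]
    exact mk_natLE_iff
  have hpred : PrimrecPred fun t : GraphCert (X ⊕ P) × Word (X ⊕ P) =>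
      0 ∈ endpoints t.1.1.2 0 t.2 :=
    primrecRel_mem.comp (Primrec.const 0) (primrec_endpoints
      (Primrec.snd.comp (Primrec.fst.comp Primrec.fst)) (Primrec.const 0) Primrec.snd)
  have hcomp : ∀ {f g : Word (X ⊕ P) × Word (X ⊕ P) → Word (X ⊕ P)}, Primrec f → Primrec g →
      Computable fun p => decide (0 ∈ endpoints (F [f p ++ invRev (f p)]).1.2 0
        (g p ++ invRev (f p))) := by
    intro f g hf hg
    have hinv := primrec_invRev.comp hf
    exact hpred.decide.to_comp.comp ((hF.comp (Primrec.list_cons.comp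
      (Primrec.list_append.comp hf hinv) (Primrec.const [])).to_comp).pair
        (Primrec.list_append.comp hg hinv).to_comp)
  refine ⟨inferInstance, ((Primrec.and.to_comp.comp (hcomp Primrec.fst Primrec.snd)
    (hcomp Primrec.snd Primrec.fst))).of_eq fun p => ?_⟩
  rw [← Bool.decide_and, decide_eq_decide, ← hle, ← hle]
  constructor
  · exact fun h => natLE_antisymm h.1 h.2
  · intro h
    rw [h]
    exact ⟨NatLE.refl _, NatLE.refl _⟩

end Main

end Immersions

theorem mainTheorem3 {X P : Type*} [Finite X] [Finite P] [Primcodable X] [Primcodable P]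
    (bl : P → Word X) :
    -- (a) Schützenberger graphs and the word problem
    ((∀ m : MXP bl, (schutzenbergerAutomaton m).IsFinite) ∧
      (∃ F : Word (X ⊕ P) → AutomatonCode (X ⊕ P), Computable F ∧
        ∀ w, (F w).Describes (schutzenbergerAutomaton (MXP.mk bl w))) ∧
      ComputablePred fun p : Word (X ⊕ P) × Word (X ⊕ P) => MXP.mk bl p.1 = MXP.mk bl p.2) ∧
    -- (b) the 2-complex of a finitely generated closed inverse submonoid
    ((∀ H : ClosedInverseSubmonoid (MXP bl), H.FG → (cosetComplex H).IsFinite) ∧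
      (∃ F : List (Word (X ⊕ P)) → ComplexCode X P, Computable F ∧
        ∀ Y : List (Word (X ⊕ P)), (F Y).Describes
          (cosetComplex (ClosedInverseSubmonoid.closure (MXP.mk bl '' {w | w ∈ Y})))) ∧
      -- the procedure of edge foldings and expansions that starts from the flower automaton
      (∀ Y : Set (Word (X ⊕ P)), Y.Finite →
        (¬ ∃ run : ℕ → Automaton (X ⊕ P), run 0 = Automaton.flower Y ∧
          ∀ n, Automaton.FoldFirstStep (CellRel bl) (run n) (run (n + 1))) ∧
        (∃ B : Automaton (X ⊕ P), Automaton.Reaches (CellRel bl) (Automaton.flower Y) B ∧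
          B.Complete (CellRel bl)) ∧
        (∀ B : Automaton (X ⊕ P), Automaton.Reaches (CellRel bl) (Automaton.flower Y) B →
          B.Complete (CellRel bl) →
          B.IsFinite ∧
            B.Iso (cosetAutomaton (ClosedInverseSubmonoid.closure (MXP.mk bl '' Y)))))) := by
  obtain ⟨F, hF, hc⟩ := exists_computable_certificate bl
  refine ⟨⟨finite_schutzenberger, ⟨fun w => ((F [w ++ FreeGroup.invRev w]).1.1,
    (F [w ++ FreeGroup.invRev w]).1.2, 0,
    (endpoints (F [w ++ FreeGroup.invRev w]).1.2 0 w).headI), ?_,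
      fun w => (hc _).describes_schutzenberger⟩, computablePred_wordProblem⟩,
    fun H hH => finite_cosetComplex hH, ⟨fun Y => ((F Y).1.1, leftEdges (F Y).1.2,
      rightEdges (F Y).1.2), ?_, fun Y => (hc Y).describes_cosetComplex⟩, fun Y hY =>
    ⟨Automaton.not_exists_infinite_run (Automaton.flower_finite hY),
      Automaton.exists_complete (Automaton.flower_finite hY),
      fun B h hB => complete_iso_coset hY h hB⟩⟩
  · have hG : Computable fun w : Word (X ⊕ P) => F [w ++ FreeGroup.invRev w] :=
      hF.comp (Primrec.list_cons.comp (Primrec.list_append.comp Primrec.id primrec_invRev)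
        (Primrec.const [])).to_comp
    have hend : Primrec fun t : GraphCert (X ⊕ P) × Word (X ⊕ P) =>
        (endpoints t.1.1.2 0 t.2).headI :=
      Primrec.list_headI.comp (primrec_endpoints
        (Primrec.snd.comp (Primrec.fst.comp Primrec.fst)) (Primrec.const 0) Primrec.snd)
    exact (Computable.fst.comp (Computable.fst.comp hG)).pair
      ((Computable.snd.comp (Computable.fst.comp hG)).pair
        ((Computable.const 0).pair (hend.to_comp.comp (hG.pair Computable.id))))
  · exact (Computable.fst.comp (Computable.fst.comp hF)).pair
      ((primrec_leftEdges.to_comp.comp (Computable.snd.comp (Computable.fst.comp hF))).pair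
        (primrec_rightEdges.to_comp.comp (Computable.snd.comp (Computable.fst.comp hF))))
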